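/- Let $n\ge 2$ be an integer and, for $\rho\in\mathbb C$, let $K_n(\rho)=[\rho^{|j-k|}]_{j,k=1}^n$. An eigenvalue $\lambda$ of $K_n(\rho)$ is called *extraordinary* if $|\lambda|>n$. It is of *type 1* if it has a skew-symmetric eigenvector $y$ ($y_{n+1-j}=-y_j$ for all $j$) and of *type 2* if it has a symmetric eigenvector ($y_{n+1-j}=y_j$ for all $j$). For $k\in\{1,2\}$ let $j_n^{(k)}(\rho)$ be the number, counting algebraic multiplicities, of type-$k$ extraordinary eigenvalues of $K_n(\rho)$. For $u\in[-\pi,\pi]$ let $v(n,u)$ be the unique $v\ge 0$ with $\sinh^2(nv)-n^2\sinh^2 v=n^2\sin^2u-\sin^2(nu)$, put $\mu=u+i\,v(n,u)$ and $$f_n^{(1)}(u)=\frac{\sin\frac{(n+1)\mu}{2}}{\sin\frac{(n-1)\mu}{2}},\qquad f_n^{(2)}(u)=\frac{\cos\frac{(n+1)\mu}{2}}{\cos\frac{(n-1)\mu}{2}}.$$ Where a quotient is $0/0$, its value is the limit: with $\xi_n=\frac{n+1}{n-1}$, this means $f_n^{(1)}(0)=\xi_n$, $f_n^{(1)}(\pm\pi)=-\xi_n$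 for odd $n$, and $f_n^{(2)}(\pm\pi)=-\xi_n$ for even $n$. Let $B_n^{(k)}=\{f_n^{(k)}(u):u\in[-\pi,\pi]\}$ be the type-$k$ borderline curve. Then, without assuming that the curves $B_n^{(k)}$ are Jordan curves, for $k=1$ and $k=2$: (a) $0\notin B_n^{(k)}$, and $j_n^{(k)}(\rho)=0$ for every $\rho$ in the connected component $O_n^{(k)}$ of $\mathbb C\setminus B_n^{(k)}$ that contains $0$; (b) $\mathbb C\setminus B_n^{(k)}$ has exactly one unbounded connected component $E_n^{(k)}$, and $j_n^{(k)}(\rho)=1$ for every $\rho\in E_n^{(k)}$. Moreover, there is an $R$ (depending on $n$) such that for every complex $\rho$ with $|\rho|>R$ the matrix $K_n(\rho)$ has, counting algebraic multiplicities, exactly two extraordinary eigenvalues; they are distinct, one of them is of type 1 and not of type 2, and the other is of type 2 and not of type 1. -/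

import Mathlib

namespace KMS

/-- The `n × n` matrix `K_n(ρ) = [ρ^{|j-k|}]`. -/
def kmsMatrix (n : ℕ) (ρ : ℂ) : Matrix (Fin n) (Fin n) ℂ :=
  Matrix.of fun j k => ρ ^ ((j : ℤ) - (k : ℤ)).natAbs

/-- The two types of eigenvalues. -/
inductive EigenType
  | type1
  | type2

/-- Skew-symmetric vectors (for type 1) and symmetric vectors (for type 2): the vector changes
sign, respectively is unchanged, when the order of its entries is reversed. -/
def HasSymmetry {n : ℕ} : EigenType → (Fin n → ℂ) → Prop
  | .type1, y => ∀ j, y (Fin.rev j) = -y j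
  | .type2, y => ∀ j, y (Fin.rev j) = y j

/-- `l` is an eigenvalue of `K_n(ρ)` of the given type: it has a skew-symmetric (type 1),
respectively symmetric (type 2), eigenvector. -/
def IsTypeEigenvalue (n : ℕ) (k : EigenType) (ρ l : ℂ) : Prop :=
  ∃ y : Fin n → ℂ,
    Module.End.HasEigenvector (Matrix.toLin' (kmsMatrix n ρ)) l y ∧ HasSymmetry k y

/-- The multiset of extraordinary eigenvalues of `K_n(ρ)` (those of modulus greater than `n`),
each repeated according to its algebraic multiplicity. -/
noncomputable def extraordinary (n : ℕ) (ρ : ℂ) : Multiset ℂ :=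
  open Classical in (kmsMatrix n ρ).charpoly.roots.filter fun l => (n : ℝ) < ‖l‖

/-- The number, counting algebraic multiplicities, of extraordinary eigenvalues of `K_n(ρ)` of
the given type. -/
noncomputable def extraordinaryCount (n : ℕ) (k : EigenType) (ρ : ℂ) : ℕ :=
  open Classical in ((extraordinary n ρ).filter (IsTypeEigenvalue n k ρ)).card

/-- `g_n(u) = n² sin² u - sin² (n u)`. -/
noncomputable def gFun (n : ℕ) (u : ℝ) : ℝ :=
  (n : ℝ) ^ 2 * Real.sin u ^ 2 - Real.sin (n * u) ^ 2

theorem abs_sin_nat_mul_le (n : ℕ) (u : ℝ) : |Real.sin (n * u)| ≤ n * |Real.sin u| := by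
  induction n with
  | zero => simp
  | succ n ih =>
    have h : ((n + 1 : ℕ) : ℝ) * u = n * u + u := by push_cast; ring
    rw [h, Real.sin_add]
    refine (abs_add_le _ _).trans ?_
    rw [abs_mul, abs_mul]
    have h1 := mul_le_mul_of_nonneg_left (Real.abs_cos_le_one u) (abs_nonneg (Real.sin (n * u)))
    have h2 := mul_le_mul_of_nonneg_right (Real.abs_cos_le_one (n * u)) (abs_nonneg (Real.sin u))
    push_cast
    linarith

theorem gFun_nonneg (n : ℕ) (u : ℝ) : 0 ≤ gFun n u := by
  have h := pow_le_pow_left₀ (abs_nonneg _) (abs_sin_nat_mul_le n u) 2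
  rw [mul_pow, sq_abs, sq_abs] at h
  unfold gFun
  linarith

theorem mul_sinh_mul_cosh_le {n : ℕ} (hn : 2 ≤ n) {v : ℝ} (hv : 0 ≤ v) :
    n * (Real.sinh v * Real.cosh v) ≤ Real.sinh (n * v) := by
  induction n, hn using Nat.le_induction with
  | base =>
    push_cast
    rw [Real.sinh_two_mul]
    linarith
  | succ n hn ih =>
    have h : ((n + 1 : ℕ) : ℝ) * v = n * v + v := by push_cast; ring
    rw [h, Real.sinh_add]
    have hs := Real.sinh_nonneg_iff.2 hv
    have hc := Real.one_le_cosh v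
    have hn1 : (1 : ℝ) ≤ n := by exact_mod_cast (by omega : 1 ≤ n)
    have hcc : Real.cosh v ≤ Real.cosh (n * v) := by
      rw [Real.cosh_le_cosh, abs_of_nonneg hv, abs_of_nonneg (by positivity)]
      nlinarith
    have h0 : 0 ≤ n * (Real.sinh v * Real.cosh v) := by positivity
    have h1 : n * (Real.sinh v * Real.cosh v) ≤ Real.sinh (n * v) * Real.cosh v := by
      nlinarith
    have h2 := mul_le_mul_of_nonneg_right hcc hs
    push_cast
    linarith

/-- The left-hand side `sinh² (n v) - n² sinh² v` of the equation defining `v(n,u)`. -/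
noncomputable def hFun (n : ℕ) (v : ℝ) : ℝ :=
  Real.sinh (n * v) ^ 2 - (n : ℝ) ^ 2 * Real.sinh v ^ 2

theorem continuous_hFun (n : ℕ) : Continuous (hFun n) := by
  unfold hFun
  fun_prop

theorem strictMonoOn_hFun {n : ℕ} (hn : 2 ≤ n) : StrictMonoOn (hFun n) (Set.Ici 0) := by
  refine strictMonoOn_of_deriv_pos (convex_Ici 0) (continuous_hFun n).continuousOn ?_
  intro v hv
  rw [interior_Ici, Set.mem_Ioi] at hv
  have hd : HasDerivAt (hFun n)
      (2 * Real.sinh (n * v) * (Real.cosh (n * v) * n)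
        - (n : ℝ) ^ 2 * (2 * Real.sinh v * Real.cosh v)) v := by
    have h1 : HasDerivAt (fun v : ℝ => (n : ℝ) * v) n v := by
      simpa using (hasDerivAt_id v).const_mul (n : ℝ)
    have h2 := (h1.sinh.pow 2).sub (((Real.hasDerivAt_sinh v).pow 2).const_mul ((n : ℝ) ^ 2))
    refine (h2.congr_deriv ?_)
    push_cast
    ring
  rw [hd.deriv]
  have hs := Real.sinh_pos_iff.2 hv
  have hc := Real.one_lt_cosh.2 hv.ne'
  have hn0 : (0 : ℝ) < n := by exact_mod_cast (by omega : 0 < n)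
  have hnv : 0 < (n : ℝ) * v := by positivity
  have hcn := Real.one_lt_cosh.2 hnv.ne'
  have h := mul_sinh_mul_cosh_le hn hv.le
  have hpos : 0 < n * (Real.sinh v * Real.cosh v) := by positivity
  have key : n * (Real.sinh v * Real.cosh v) < Real.sinh (n * v) * Real.cosh (n * v) := by
    nlinarith
  have := mul_lt_mul_of_pos_left key hn0
  nlinarith

theorem existsUnique_v {n : ℕ} (hn : 2 ≤ n) (u : ℝ) :
    ∃! v : ℝ, 0 ≤ v ∧ hFun n v = gFun n u := by
  have hg := gFun_nonneg n u
  have h0 : hFun n 0 = 0 := by simp [hFun]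
  have hn1 : (1 : ℝ) ≤ n := by exact_mod_cast (by omega : 1 ≤ n)
  set t : ℝ := gFun n u + 1 with ht
  have ht1 : 1 ≤ t := by linarith
  have hbig : gFun n u ≤ hFun n t := by
    have ht0 : 0 ≤ t := by linarith
    have h := mul_sinh_mul_cosh_le hn ht0
    have hs : t ≤ Real.sinh t := Real.self_le_sinh_iff.2 ht0
    have hs0 : 0 ≤ Real.sinh t := ht0.trans hs
    have hc := Real.cosh_pos t
    have hsq := pow_le_pow_left₀ (by positivity) h 2
    have e : (n * (Real.sinh t * Real.cosh t)) ^ 2 - (n : ℝ) ^ 2 * Real.sinh t ^ 2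
        = (n : ℝ) ^ 2 * (Real.sinh t ^ 2) ^ 2 := by
      rw [mul_pow, mul_pow, Real.cosh_sq]
      ring
    have h1 : t ≤ Real.sinh t ^ 2 := by nlinarith
    have h2 : t ≤ (Real.sinh t ^ 2) ^ 2 := by nlinarith
    have h3 : (Real.sinh t ^ 2) ^ 2 ≤ (n : ℝ) ^ 2 * (Real.sinh t ^ 2) ^ 2 := by
      have : (1 : ℝ) ≤ (n : ℝ) ^ 2 := one_le_pow₀ hn1
      nlinarith [sq_nonneg (Real.sinh t ^ 2)]
    unfold hFun
    linarith
  obtain ⟨v, hv, hv'⟩ := intermediate_value_Icc (by linarith : (0 : ℝ) ≤ t)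
    (continuous_hFun n).continuousOn ⟨h0.trans_le hg, hbig⟩
  refine ⟨v, ⟨hv.1, hv'⟩, ?_⟩
  rintro w ⟨hw, hw'⟩
  exact (strictMonoOn_hFun hn).injOn hw hv.1 (hw'.trans hv'.symm)

/-- `v(n,u)`: for `n ≥ 2`, the unique `v ≥ 0` with `sinh² (n v) - n² sinh² v = g_n(u)`
(and `0` for the unused values `n < 2`). -/
noncomputable def vFun (n : ℕ) (u : ℝ) : ℝ :=
  open Classical in if hn : 2 ≤ n then (existsUnique_v hn u).choose else 0

theorem vFun_spec {n : ℕ} (hn : 2 ≤ n) (u : ℝ) :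
    0 ≤ vFun n u ∧ hFun n (vFun n u) = gFun n u := by
  rw [vFun, dif_pos hn]
  exact (existsUnique_v hn u).choose_spec.1

/-- `μ(n,u) = u + i v(n,u)`. -/
noncomputable def muFun (n : ℕ) (u : ℝ) : ℂ :=
  (u : ℂ) + (vFun n u : ℂ) * Complex.I

/-- `ξ_n = (n+1)/(n-1)`. -/
noncomputable def xi (n : ℕ) : ℂ := ((n : ℂ) + 1) / ((n : ℂ) - 1)

/-- The parametrization `f_n^{(k)}(u)`, `-π ≤ u ≤ π`, of the borderline curve, with
`f_n^{(1)}(u) = sin((n+1)μ/2) / sin((n-1)μ/2)` and `f_n^{(2)}(u) = cos((n+1)μ/2) / cos((n-1)μ/2)`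
at `μ = μ(n,u)`. Where the quotient is `0/0`, namely at `u = 0` for type 1, at `u = ±π` for type 1
and odd `n`, and at `u = ±π` for type 2 and even `n`, the value is the limit `±ξ_n`. -/
noncomputable def fFun (n : ℕ) (k : EigenType) (u : ℝ) : ℂ :=
  open Classical in
  match k with
  | .type1 =>
    if u = 0 then xi n
    else if (u = Real.pi ∨ u = -Real.pi) ∧ Odd n then -xi n
    else Complex.sin (((n : ℂ) + 1) * muFun n u / 2) / Complex.sin (((n : ℂ) - 1) * muFun n u / 2)
  | .type2 =>
    if (u = Real.pi ∨ u = -Real.pi) ∧ Even n then -xi n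
    else Complex.cos (((n : ℂ) + 1) * muFun n u / 2) / Complex.cos (((n : ℂ) - 1) * muFun n u / 2)

/-- The borderline curve `B_n^{(k)}`, as a subset of the plane. -/
noncomputable def borderlineCurve (n : ℕ) (k : EigenType) : Set ℂ :=
  fFun n k '' Set.Icc (-Real.pi) Real.pi

/-- `C` is a connected component of the complement of `B`. -/
def IsComplComponent (B C : Set ℂ) : Prop :=
  ∃ z ∈ Bᶜ, C = connectedComponentIn Bᶜ z

end KMS

/-!
Write `J` for the reversal of coordinates. It commutes with `K = K_n(ρ)`, so `K` splits into a
skew-symmetric and a symmetric part. `typeBlock k K` acts as `K` on the vectors of type `k` and as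
the identity on the others; the product of the two characteristic polynomials is
`(X - 1) ^ n * K.charpoly`. For `ρ ≠ 0` an eigenvector with nonzero eigenvalue is determined by its
first entry, so no extraordinary eigenvalue is of both types, and the number of extraordinary
eigenvalues of type `k` is the number of eigenvalues of `typeBlock k K` of modulus greater than `n`
(`extraordinaryCount_eq_eigenCount`).

Eigenvalues depend continuously on the matrix (`eventually_eigenCount_eq`), so this number can only
change at a `ρ` for which there is an eigenvalue `l` of type `k` with `|l| = n`. Such a `ρ` lies on
the borderline curve (`mem_borderlineCurve`). Indeed, choose `μ` with
`l (1 - 2 ρ cos μ + ρ²) = 1 - ρ²`. The eigenvector, continued to `ℤ` by the kernel `ρ^|j-k|`,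
satisfies the recurrence with characteristic roots `exp (± i μ)`; comparing it with the solution of
the same symmetry through their Casoratian gives `ρ = sin ((n+1)μ/2) / sin ((n-1)μ/2)`, with
cosines for type 2, and then `l = ∓ sin (n μ) / sin μ`. Thus `|l| = n` is the equation defining
`v(n,u)`. Where `sin μ = 0`, a linear function takes the place of the sine or cosine and yields the
exceptional values `± ξ_n`. Consequently the number of extraordinary eigenvalues of type `k` is
constant on the components of the complement of the curve.

It remains to evaluate this number once in each of the two components. At `ρ = 0` the matrix is the
identity, and `0` is not on the curve. For large `|ρ|` (the curve is bounded,
`exists_bound_borderlineCurve`), the tridiagonal inverse of `K` tends to `diag (0, -1, …, -1, 0)` as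
`ρ⁻¹ → 0`. This limit has exactly two eigenvalues in `|z| < 1/n`, and each of its type blocks has at
least one, namely `0` with eigenvector `e₁ ± eₙ`; so each block has exactly one, and the same holds
for the inverse of `K` when `|ρ|` is large (`exists_extraordinaryCount_eq_one`).
-/

open Filter Topology

namespace KMS

/-! ### Counting the roots of a characteristic polynomial -/

/-- The number, counting algebraic multiplicities, of eigenvalues of `A` that satisfy `p`. -/
noncomputable def eigenCount {n : ℕ} (p : ℂ → Prop) (A : Matrix (Fin n) (Fin n) ℂ) : ℕ :=
  open Classical in A.charpoly.roots.countP p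

theorem exists_charpoly_roots_eq_map {n : ℕ} (A : Matrix (Fin n) (Fin n) ℂ) :
    ∃ r : Fin n → ℂ, A.charpoly.roots = Finset.univ.val.map r := by
  have hc : A.charpoly.roots.card = n := by
    rw [← (IsAlgClosed.splits A.charpoly).natDegree_eq_card_roots, A.charpoly_natDegree_eq_dim,
      Fintype.card_fin]
  obtain ⟨l, hl⟩ := Quot.exists_rep A.charpoly.roots
  change (l : Multiset ℂ) = _ at hl
  have hlen : l.length = n := by rw [← hc, ← hl]; rfl
  subst hlen
  refine ⟨l.get, ?_⟩
  rw [← hl, Fin.univ_val_map, List.ofFn_get]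

theorem charpoly_eval_eq_prod {n : ℕ} (A : Matrix (Fin n) (Fin n) ℂ) {r : Fin n → ℂ}
    (h : A.charpoly.roots = Finset.univ.val.map r) (z : ℂ) :
    A.charpoly.eval z = ∏ i, (z - r i) := by
  conv_lhs => rw [(IsAlgClosed.splits A.charpoly).eq_prod_roots_of_monic A.charpoly_monic, h]
  rw [Multiset.map_map, Polynomial.eval_multiset_prod, Multiset.map_map]
  simp [Finset.prod]

/-- Nonzero points suffice to recognise the characteristic polynomial; this is what the comparison
with an inverse matrix provides. -/
theorem charpoly_roots_of_eval {n : ℕ} (A : Matrix (Fin n) (Fin n) ℂ) (r : Fin n → ℂ)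
    (h : ∀ z ≠ 0, A.charpoly.eval z = ∏ i, (z - r i)) :
    A.charpoly.roots = Finset.univ.val.map r := by
  have hX : A.charpoly * Polynomial.X =
      (∏ i, (Polynomial.X - Polynomial.C (r i))) * Polynomial.X := by
    refine Polynomial.funext fun z => ?_
    rcases eq_or_ne z 0 with rfl | hz
    · simp
    · simp [Polynomial.eval_prod, h z hz]
  rw [mul_right_cancel₀ Polynomial.X_ne_zero hX]
  exact Polynomial.roots_multiset_prod_X_sub_C (Finset.univ.val.map r) ▸ by
    rw [Multiset.map_map]; rfl

theorem eigenCount_eq_card {n : ℕ} (p : ℂ → Prop) [DecidablePred p]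
    (A : Matrix (Fin n) (Fin n) ℂ) {r : Fin n → ℂ}
    (h : A.charpoly.roots = Finset.univ.val.map r) :
    eigenCount p A = (Finset.univ.filter fun i => p (r i)).card := by
  classical
  rw [eigenCount, h, Multiset.countP_map]
  simp only [Finset.card, Finset.filter]
  congr!

/-- If `B` is inverse to `A`, then its eigenvalues are the inverses of those of `A`. -/
theorem eigenCount_of_mul_eq_one {n : ℕ} (p : ℂ → Prop) {A B : Matrix (Fin n) (Fin n) ℂ}
    (hAB : A * B = 1) : eigenCount p B = eigenCount (fun z => p z⁻¹) A := by
  classical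
  obtain ⟨r, hr⟩ := exists_charpoly_roots_eq_map A
  have hdet : A.det * B.det = 1 := by rw [← Matrix.det_mul, hAB, Matrix.det_one]
  have hA : A.det = ∏ i, r i := by
    rw [Matrix.det_eq_prod_roots_charpoly, hr]; rfl
  have hr0 : ∀ i, r i ≠ 0 := by
    intro i hi
    rw [hA, Finset.prod_eq_zero (Finset.mem_univ i) hi, zero_mul] at hdet
    exact zero_ne_one hdet
  have hB : B.charpoly.roots = Finset.univ.val.map fun i => (r i)⁻¹ := by
    refine charpoly_roots_of_eval B _ fun z hz => ?_
    have e : Matrix.scalar (Fin n) z - B = -(z • ((Matrix.scalar (Fin n) z⁻¹ - A) * B)) := by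
      simp only [Matrix.scalar_apply, sub_mul, hAB, ← Matrix.smul_one_eq_diagonal]
      simp [smul_sub, smul_smul, hz]
    have h1 : A.det * B.charpoly.eval z = A.det * ∏ i, (z - (r i)⁻¹) := by
      rw [Matrix.eval_charpoly, e, Matrix.det_neg, Matrix.det_smul, Matrix.det_mul,
        ← Matrix.eval_charpoly, charpoly_eval_eq_prod A hr]
      calc _ = (A.det * B.det) * ((-1) ^ n * (z ^ n * ∏ i, (z⁻¹ - r i))) := by
            rw [Fintype.card_fin]; ring
        _ = ∏ i : Fin n, (-1) * (z * (z⁻¹ - r i)) := by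
            rw [hdet, Finset.prod_mul_distrib, Finset.prod_mul_distrib]; simp
        _ = _ := by
            rw [hA, ← Finset.prod_mul_distrib]
            refine Finset.prod_congr rfl fun i _ => ?_
            have := hr0 i
            field_simp
            ring
    exact mul_left_cancel₀ (left_ne_zero_of_mul_eq_one hdet) h1
  rw [eigenCount_eq_card p B hB, eigenCount_eq_card _ A hr]

/-- A crude bound on the eigenvalues, from Gershgorin's circle theorem. -/
theorem norm_root_le {n : ℕ} {A : Matrix (Fin n) (Fin n) ℂ} {M : ℝ}
    (hM : ∀ i j, ‖A i j‖ ≤ M) {r : ℂ} (hr : r ∈ A.charpoly.roots) : ‖r‖ ≤ n * M := by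
  have h := Matrix.mem_spectrum_of_isRoot_charpoly (Polynomial.isRoot_of_mem_roots hr)
  rw [← Matrix.spectrum_toLin', ← Module.End.hasEigenvalue_iff_mem_spectrum] at h
  obtain ⟨k, hk⟩ := eigenvalue_mem_ball h
  have hn : (1 : ℝ) ≤ n := by exact_mod_cast (Nat.one_le_iff_ne_zero.2 (by rintro rfl; exact k.elim0))
  calc ‖r‖ = ‖(r - A k k) + A k k‖ := by rw [sub_add_cancel]
    _ ≤ ‖r - A k k‖ + ‖A k k‖ := norm_add_le _ _
    _ ≤ ∑ j ∈ Finset.univ.erase k, ‖A k j‖ + ‖A k k‖ := by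
        gcongr; simpa [dist_eq_norm] using hk
    _ = ∑ j, ‖A k j‖ := Finset.sum_erase_add _ _ (Finset.mem_univ k)
    _ ≤ ∑ _j : Fin n, M := Finset.sum_le_sum fun j _ => hM k j
    _ = n * M := by simp

/-- Continuity of eigenvalues: if membership in `p` is locally constant at every eigenvalue of
`F x₀`, then the number of eigenvalues of `F x` in `p` is constant near `x₀`. Along an ultrafilter
converging to `x₀` the eigenvalues, listed with multiplicities, converge by compactness, and their
limits are the eigenvalues of `F x₀`. -/
theorem eventually_eigenCount_eq {n : ℕ} {X : Type*} [TopologicalSpace X]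
    {F : X → Matrix (Fin n) (Fin n) ℂ} {x₀ : X} (hF : ContinuousAt F x₀) (p : ℂ → Prop)
    (hp : ∀ r ∈ (F x₀).charpoly.roots, ∀ᶠ z in 𝓝 r, (p z ↔ p r)) :
    ∀ᶠ x in 𝓝 x₀, eigenCount p (F x) = eigenCount p (F x₀) := by
  classical
  by_contra hfr
  rw [not_eventually] at hfr
  have : (𝓝 x₀ ⊓ 𝓟 {x | ¬ eigenCount p (F x) = eigenCount p (F x₀)}).NeBot :=
    frequently_mem_iff_neBot.1 hfr
  obtain ⟨U, hU'⟩ := Ultrafilter.exists_le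
    (𝓝 x₀ ⊓ 𝓟 {x | ¬ eigenCount p (F x) = eigenCount p (F x₀)})
  have hU : (U : Filter X) ≤ 𝓝 x₀ := hU'.trans inf_le_left
  have hne : ∀ᶠ x in (U : Filter X), ¬ eigenCount p (F x) = eigenCount p (F x₀) :=
    hU' (mem_inf_of_right (mem_principal_self _))
  choose r hr using fun x => exists_charpoly_roots_eq_map (F x)
  have hent : ∀ i j, Tendsto (fun x => F x i j) (𝓝 x₀) (𝓝 (F x₀ i j)) := fun i j =>
    ((continuous_apply_apply i j).tendsto _).comp hF
  obtain ⟨M, hM⟩ : ∃ M : ℝ, ∀ᶠ x in 𝓝 x₀, ∀ i j, ‖F x i j‖ ≤ M := by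
    refine ⟨∑ i, ∑ j, (‖F x₀ i j‖ + 1), ?_⟩
    rw [eventually_all]; intro i
    rw [eventually_all]; intro j
    have h1 : ∀ᶠ x in 𝓝 x₀, ‖F x i j‖ < ‖F x₀ i j‖ + 1 :=
      (hent i j).norm.eventually_lt_const (lt_add_one _)
    filter_upwards [h1] with x hx
    refine hx.le.trans ?_
    have h2 : ∀ i, 0 ≤ ∑ j, (‖F x₀ i j‖ + 1) := fun i =>
      Finset.sum_nonneg fun j _ => by positivity
    refine le_trans ?_ (Finset.single_le_sum (fun i _ => h2 i) (Finset.mem_univ i))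
    exact Finset.single_le_sum (f := fun j => ‖F x₀ i j‖ + 1) (fun j _ => by positivity)
      (Finset.mem_univ j)
  have hcpt : IsCompact (Set.univ.pi fun _ : Fin n => Metric.closedBall (0 : ℂ) (n * M)) :=
    isCompact_univ_pi fun _ => isCompact_closedBall _ _
  have hmem : ∀ᶠ x in (U : Filter X), r x ∈
      Set.univ.pi fun _ : Fin n => Metric.closedBall (0 : ℂ) (n * M) := by
    filter_upwards [hU hM] with x hx i _
    rw [mem_closedBall_zero_iff]
    exact norm_root_le hx (by rw [hr]; exact Multiset.mem_map_of_mem _ (Finset.mem_univ i))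
  obtain ⟨s, -, hs⟩ := isCompact_iff_ultrafilter_le_nhds'.1 hcpt (U.map r) hmem
  have hs' : ∀ i, Tendsto (fun x => r x i) U (𝓝 (s i)) := fun i =>
    ((continuous_apply i).tendsto s).comp hs
  have hroots : (F x₀).charpoly.roots = Finset.univ.val.map s := by
    refine charpoly_roots_of_eval _ _ fun z _ => ?_
    have h1 : Tendsto (fun x => (F x).charpoly.eval z) U (𝓝 ((F x₀).charpoly.eval z)) := by
      simp only [Matrix.eval_charpoly]
      have : Continuous fun A : Matrix (Fin n) (Fin n) ℂ => (Matrix.scalar (Fin n) z - A).det :=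
        (continuous_const.sub continuous_id).matrix_det
      exact (this.continuousAt.comp hF).tendsto.mono_left hU
    have h2 : Tendsto (fun x => (F x).charpoly.eval z) U (𝓝 (∏ i, (z - s i))) := by
      simp only [charpoly_eval_eq_prod _ (hr _)]
      exact tendsto_finsetProd _ fun i _ => tendsto_const_nhds.sub (hs' i)
    exact tendsto_nhds_unique h1 h2
  have hall : ∀ᶠ x in (U : Filter X), ∀ i, (p (r x i) ↔ p (s i)) := by
    rw [eventually_all]
    intro i
    exact (hs' i).eventually
      (hp (s i) (by rw [hroots]; exact Multiset.mem_map_of_mem _ (Finset.mem_univ i)))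
  obtain ⟨x, hx, hx'⟩ := (hne.and hall).exists
  apply hx
  rw [eigenCount_eq_card p _ (hr x), eigenCount_eq_card p _ hroots]
  simp only [hx']

/-! ### Splitting a reversal-invariant matrix into its skew-symmetric and symmetric parts -/

/-- The sign with which reversal acts on vectors of the given type. -/
def EigenType.sign : EigenType → ℂ
  | .type1 => -1
  | .type2 => 1

theorem EigenType.sign_sq (k : EigenType) : k.sign * k.sign = 1 := by
  cases k <;> simp [EigenType.sign]

theorem hasSymmetry_iff {n : ℕ} (k : EigenType) (y : Fin n → ℂ) :
    HasSymmetry k y ↔ ∀ j, y (Fin.rev j) = k.sign * y j := by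
  cases k <;> simp [HasSymmetry, EigenType.sign]

/-- The permutation matrix of the reversal of `Fin n`. -/
def revMatrix (n : ℕ) : Matrix (Fin n) (Fin n) ℂ :=
  Matrix.of fun i j => if j = Fin.rev i then 1 else 0

theorem revMatrix_mul_apply {n : ℕ} (A : Matrix (Fin n) (Fin n) ℂ) (i j : Fin n) :
    (revMatrix n * A) i j = A (Fin.rev i) j := by
  simp [revMatrix, Matrix.mul_apply]

theorem mul_revMatrix_apply {n : ℕ} (A : Matrix (Fin n) (Fin n) ℂ) (i j : Fin n) :
    (A * revMatrix n) i j = A i (Fin.rev j) := by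
  have h : ∀ x : Fin n, j = Fin.rev x ↔ x = Fin.rev j := fun x => by
    rw [eq_comm, Fin.rev_eq_iff]
  simp [revMatrix, Matrix.mul_apply, h]

theorem revMatrix_mul_self (n : ℕ) : revMatrix n * revMatrix n = 1 := by
  ext i j
  rw [revMatrix_mul_apply]
  simp [revMatrix, Matrix.one_apply, eq_comm]

theorem revMatrix_mulVec {n : ℕ} (y : Fin n → ℂ) (i : Fin n) :
    (revMatrix n).mulVec y i = y (Fin.rev i) := by
  simp [revMatrix, Matrix.mulVec, dotProduct]

theorem commute_revMatrix {n : ℕ} {A : Matrix (Fin n) (Fin n) ℂ}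
    (hA : ∀ i j, A (Fin.rev i) (Fin.rev j) = A i j) : Commute A (revMatrix n) := by
  ext i j
  rw [revMatrix_mul_apply, mul_revMatrix_apply, ← hA, Fin.rev_rev]

/-- The projection onto the vectors of type `k` along those of the other type. -/
noncomputable def typeProj (n : ℕ) (k : EigenType) : Matrix (Fin n) (Fin n) ℂ :=
  (2⁻¹ : ℂ) • (1 + k.sign • revMatrix n)

theorem typeProj_mul_self (n : ℕ) (k : EigenType) :
    typeProj n k * typeProj n k = typeProj n k := by
  have h : 2⁻¹ * k.sign * (2⁻¹ * k.sign) = 4⁻¹ := by linear_combination 4⁻¹ * k.sign_sq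
  simp only [typeProj, smul_mul_smul_comm, add_mul, mul_add, one_mul, mul_one,
    smul_add, revMatrix_mul_self, smul_smul, h]
  module

theorem typeProj_type1 (n : ℕ) : typeProj n .type1 = 1 - typeProj n .type2 := by
  simp only [typeProj, EigenType.sign]
  module

theorem hasSymmetry_of_typeProj_mulVec {n : ℕ} {k : EigenType} {y : Fin n → ℂ}
    (h : (typeProj n k).mulVec y = y) : HasSymmetry k y := by
  rw [hasSymmetry_iff]
  intro j
  have h1 := congrFun h j
  simp only [typeProj, Matrix.smul_mulVec, Matrix.add_mulVec, Matrix.one_mulVec, Pi.smul_apply,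
    Pi.add_apply, revMatrix_mulVec, smul_eq_mul] at h1
  linear_combination 2 * k.sign * h1 - y j.rev * k.sign_sq

theorem typeProj_mulVec {n : ℕ} {k : EigenType} {y : Fin n → ℂ}
    (h : HasSymmetry k y) : (typeProj n k).mulVec y = y := by
  rw [hasSymmetry_iff] at h
  ext j
  simp only [typeProj, Matrix.smul_mulVec, Matrix.add_mulVec, Matrix.one_mulVec, Pi.smul_apply,
    Pi.add_apply, revMatrix_mulVec, smul_eq_mul, h]
  linear_combination 2⁻¹ * y j * k.sign_sq

/-- The matrix that acts as `A` on the vectors of type `k` and as the identity on those of the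
other type, provided that `A` commutes with reversal. The identity rather than `0` is chosen on the
complement so that invertibility is preserved. -/
noncomputable def typeBlock {n : ℕ} (k : EigenType) (A : Matrix (Fin n) (Fin n) ℂ) :
    Matrix (Fin n) (Fin n) ℂ :=
  A * typeProj n k + (1 - typeProj n k)

theorem commute_typeProj {n : ℕ} {A : Matrix (Fin n) (Fin n) ℂ} (hA : Commute A (revMatrix n))
    (k : EigenType) : Commute A (typeProj n k) :=
  ((Commute.one_right A).add_right (hA.smul_right _)).smul_right _

theorem typeBlock_mul {n : ℕ} (k : EigenType) (A : Matrix (Fin n) (Fin n) ℂ)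
    {B : Matrix (Fin n) (Fin n) ℂ} (hB : Commute B (revMatrix n)) :
    typeBlock k A * typeBlock k B = typeBlock k (A * B) := by
  have hP := typeProj_mul_self n k
  have hc := (commute_typeProj hB k).eq
  have e1 : A * typeProj n k * (B * typeProj n k) = A * B * typeProj n k := by
    rw [hc, mul_assoc A, ← mul_assoc (typeProj n k) (typeProj n k), hP, ← hc, mul_assoc]
  have e2 : typeProj n k * (B * typeProj n k) = B * typeProj n k := by
    rw [hc, ← mul_assoc, hP]
  simp only [typeBlock, mul_add, add_mul, mul_sub, sub_mul, mul_one, one_mul, e1, e2, hP,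
    mul_assoc A (typeProj n k) (typeProj n k)]
  abel

@[simp] theorem typeBlock_one {n : ℕ} (k : EigenType) :
    typeBlock k (1 : Matrix (Fin n) (Fin n) ℂ) = 1 := by
  simp [typeBlock]

theorem typeBlock_charpoly_mul {n : ℕ} {A : Matrix (Fin n) (Fin n) ℂ}
    (hA : Commute A (revMatrix n)) :
    (typeBlock .type1 A).charpoly * (typeBlock .type2 A).charpoly =
      (Polynomial.X - Polynomial.C 1) ^ n * A.charpoly := by
  refine Polynomial.funext fun z => ?_
  have hP := typeProj_mul_self n .type2
  have hc := (commute_typeProj hA .type2).eq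
  have e3 : typeProj n .type2 * (A * typeProj n .type2) = A * typeProj n .type2 := by
    rw [hc, ← mul_assoc, hP]
  have key : (Matrix.scalar (Fin n) z - typeBlock .type1 A) *
      (Matrix.scalar (Fin n) z - typeBlock .type2 A) =
      (z - 1) • (Matrix.scalar (Fin n) z - A) := by
    simp only [typeBlock, typeProj_type1, Matrix.scalar_apply, ← Matrix.smul_one_eq_diagonal]
    simp only [mul_add, add_mul, mul_sub, sub_mul, mul_one, one_mul, e3, hP, smul_sub,
      sub_smul, smul_mul_assoc, mul_smul_comm, one_smul, smul_add, mul_assoc]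
    abel
  simp only [Polynomial.eval_mul, Matrix.eval_charpoly, Polynomial.eval_pow, Polynomial.eval_sub,
    Polynomial.eval_X, Polynomial.eval_C]
  rw [← Matrix.det_mul, key, Matrix.det_smul, Fintype.card_fin]

theorem typeBlock_roots_filter {n : ℕ} {A : Matrix (Fin n) (Fin n) ℂ}
    (hA : Commute A (revMatrix n)) (p : ℂ → Prop) [DecidablePred p] (hp : ¬ p 1) :
    (typeBlock .type1 A).charpoly.roots.filter p + (typeBlock .type2 A).charpoly.roots.filter p =
      A.charpoly.roots.filter p := by
  have h1 := (typeBlock .type1 A).charpoly_monic.ne_zero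
  have h2 := (typeBlock .type2 A).charpoly_monic.ne_zero
  rw [← Multiset.filter_add, ← Polynomial.roots_mul (mul_ne_zero h1 h2), typeBlock_charpoly_mul hA,
    Polynomial.roots_mul (mul_ne_zero (pow_ne_zero _ (Polynomial.X_sub_C_ne_zero 1))
      A.charpoly_monic.ne_zero), Multiset.filter_add, Polynomial.roots_pow,
    Polynomial.roots_X_sub_C]
  rw [Multiset.filter_eq_nil.2, zero_add]
  intro a ha
  rw [Multiset.mem_singleton.1 (Multiset.mem_of_mem_nsmul ha)]
  exact hp

theorem eigenCount_typeBlock_add {n : ℕ} {A : Matrix (Fin n) (Fin n) ℂ}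
    (hA : Commute A (revMatrix n)) (p : ℂ → Prop) (hp : ¬ p 1) :
    eigenCount p (typeBlock .type1 A) + eigenCount p (typeBlock .type2 A) = eigenCount p A := by
  classical
  simp only [eigenCount, Multiset.countP_eq_card_filter]
  rw [← typeBlock_roots_filter hA p hp, Multiset.card_add]

/-- An eigenvalue of a type block other than `1` has an eigenvector of that type. -/
theorem exists_eigenvector_of_mem_roots_typeBlock {n : ℕ} {A : Matrix (Fin n) (Fin n) ℂ}
    (hA : Commute A (revMatrix n)) {k : EigenType} {l : ℂ}
    (hl : l ∈ (typeBlock k A).charpoly.roots) (hl1 : l ≠ 1) :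
    ∃ y : Fin n → ℂ, y ≠ 0 ∧ A.mulVec y = l • y ∧ HasSymmetry k y := by
  have h := Matrix.mem_spectrum_of_isRoot_charpoly (Polynomial.isRoot_of_mem_roots hl)
  rw [← Matrix.spectrum_toLin', ← Module.End.hasEigenvalue_iff_mem_spectrum] at h
  obtain ⟨y, hy⟩ := h.exists_hasEigenvector
  have hy1 : (typeBlock k A).mulVec y = l • y := by simpa using hy.apply_eq_smul
  have hP := typeProj_mul_self n k
  have hc := (commute_typeProj hA k).eq
  have e1 : (1 - typeProj n k) * typeBlock k A = 1 - typeProj n k := by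
    have : typeProj n k * (A * typeProj n k) = A * typeProj n k := by
      rw [hc, ← mul_assoc, hP]
    simp only [typeBlock, mul_add, sub_mul, mul_sub, one_mul, mul_one, this, hP]
    abel
  have e2 : (1 - typeProj n k).mulVec y = l • (1 - typeProj n k).mulVec y := by
    conv_lhs => rw [← e1, ← Matrix.mulVec_mulVec, hy1, Matrix.mulVec_smul]
  have e3 : (1 - typeProj n k).mulVec y = 0 := by
    have : (1 - l) • (1 - typeProj n k).mulVec y = 0 := by
      rw [sub_smul, one_smul, ← e2, sub_self]
    exact (smul_eq_zero.1 this).resolve_left (sub_ne_zero.2 hl1.symm)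
  have e4 : (typeProj n k).mulVec y = y := by
    rw [Matrix.sub_mulVec, Matrix.one_mulVec, sub_eq_zero] at e3
    exact e3.symm
  refine ⟨y, hy.2, ?_, hasSymmetry_of_typeProj_mulVec e4⟩
  rw [typeBlock, Matrix.add_mulVec, e3, add_zero, ← Matrix.mulVec_mulVec, e4] at hy1
  exact hy1

/-! ### Eigenvectors of `K_n(ρ)` -/

theorem kmsMatrix_apply (n : ℕ) (ρ : ℂ) (i j : Fin n) :
    kmsMatrix n ρ i j = ρ ^ ((i : ℤ) - (j : ℤ)).natAbs := rfl

theorem commute_kmsMatrix (n : ℕ) (ρ : ℂ) : Commute (kmsMatrix n ρ) (revMatrix n) := by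
  refine commute_revMatrix fun i j => ?_
  rw [kmsMatrix_apply, kmsMatrix_apply]
  congr 1
  simp only [Fin.val_rev]
  omega

theorem continuous_kmsMatrix (n : ℕ) : Continuous (kmsMatrix n) := by
  refine continuous_matrix fun i j => ?_
  simp only [kmsMatrix_apply]
  fun_prop

theorem kmsMatrix_zero (n : ℕ) : kmsMatrix n 0 = 1 := by
  ext i j
  rw [kmsMatrix_apply, Matrix.one_apply]
  split_ifs with h
  · simp [h]
  · refine zero_pow ?_
    have := Fin.val_ne_of_ne h
    omega

/-- Up to the factor `1 - ρ²`, the kernel `ρ^|m|` on `ℤ` is the Green function of the difference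
operator with coefficients `-ρ, 1 + ρ², -ρ`. -/
theorem pow_natAbs_recurrence (ρ : ℂ) (m : ℤ) :
    (1 + ρ ^ 2) * ρ ^ m.natAbs - ρ * (ρ ^ (m - 1).natAbs + ρ ^ (m + 1).natAbs) =
      if m = 0 then 1 - ρ ^ 2 else 0 := by
  rcases m with (_ | a) | a
  · simp
    ring
  · have h1 : (Int.ofNat (a + 1)).natAbs = a + 1 := rfl
    have h2 : (Int.ofNat (a + 1) - 1).natAbs = a := by simp
    have h3 : (Int.ofNat (a + 1) + 1).natAbs = a + 2 := by simp; omega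
    rw [h1, h2, h3, if_neg (by simp; omega)]
    ring
  · have h1 : (Int.negSucc a).natAbs = a + 1 := rfl
    have h2 : (Int.negSucc a - 1).natAbs = a + 2 := by omega
    have h3 : (Int.negSucc a + 1).natAbs = a := by omega
    rw [h1, h2, h3, if_neg (by omega)]
    ring

/-- The two-sided sequence `j ↦ ∑ₖ ρ^|j-k| y_k`, which continues the vector `K_n(ρ) y` to all
integer indices. -/
noncomputable def kmsExtension {n : ℕ} (ρ : ℂ) (y : Fin n → ℂ) (j : ℤ) : ℂ :=
  ∑ k : Fin n, ρ ^ (j - (k : ℤ)).natAbs * y k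

theorem kmsMatrix_mulVec {n : ℕ} (ρ : ℂ) (y : Fin n → ℂ) (j : Fin n) :
    (kmsMatrix n ρ).mulVec y j = kmsExtension ρ y j := rfl

theorem kmsExtension_recurrence {n : ℕ} (ρ : ℂ) (y : Fin n → ℂ) (j : Fin n) :
    (1 + ρ ^ 2) * kmsExtension ρ y j -
      ρ * (kmsExtension ρ y (j - 1) + kmsExtension ρ y (j + 1)) = (1 - ρ ^ 2) * y j := by
  have h : ∀ k : Fin n, (1 + ρ ^ 2) * (ρ ^ ((j : ℤ) - k).natAbs * y k) -
      ρ * (ρ ^ ((j : ℤ) - 1 - k).natAbs * y k + ρ ^ ((j : ℤ) + 1 - k).natAbs * y k) =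
      if j = k then (1 - ρ ^ 2) * y k else 0 := by
    intro k
    have h1 := pow_natAbs_recurrence ρ ((j : ℤ) - k)
    rw [show (j : ℤ) - 1 - k = (j : ℤ) - k - 1 by ring,
      show (j : ℤ) + 1 - k = (j : ℤ) - k + 1 by ring]
    have h2 : ((j : ℤ) - k = 0) ↔ j = k := by rw [Fin.ext_iff]; omega
    simp only [h2] at h1
    split_ifs at h1 ⊢ <;> linear_combination y k * h1
  simp only [kmsExtension, Finset.mul_sum, ← Finset.sum_add_distrib, ← Finset.sum_sub_distrib, h]
  simp

theorem kmsExtension_neg_one {n : ℕ} (ρ : ℂ) (y : Fin n → ℂ) :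
    kmsExtension ρ y (-1) = ρ * kmsExtension ρ y 0 := by
  simp only [kmsExtension, Finset.mul_sum]
  refine Finset.sum_congr rfl fun k _ => ?_
  rw [← mul_assoc, ← pow_succ']
  congr 2
  omega

theorem kmsExtension_rev {n : ℕ} (ρ : ℂ) {y : Fin n → ℂ} {k : EigenType} (hy : HasSymmetry k y)
    (j : ℤ) : kmsExtension ρ y (n - 1 - j) = k.sign * kmsExtension ρ y j := by
  rw [hasSymmetry_iff] at hy
  simp only [kmsExtension, Finset.mul_sum]
  rw [← Equiv.sum_comp Fin.revPerm]
  refine Finset.sum_congr rfl fun i _ => ?_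
  rw [Fin.revPerm_apply, hy, mul_left_comm, Fin.val_rev]
  congr 3
  omega

section Eigenvector

variable {n : ℕ} {ρ l w : ℂ} {y : Fin n → ℂ}

theorem kmsExtension_of_eigenvector (hy : (kmsMatrix n ρ).mulVec y = l • y) (j : Fin n) :
    kmsExtension ρ y j = l * y j := by
  rw [← kmsMatrix_mulVec, hy, Pi.smul_apply, smul_eq_mul]

/-- The extension of an eigenvector satisfies the three-term recurrence with coefficient `2 w`,
`w` being determined by `l (1 - 2 ρ w + ρ²) = 1 - ρ²`. -/
theorem kmsExtension_three_term (hρ : ρ ≠ 0) (hl : l ≠ 0)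
    (hw : l * (1 - 2 * ρ * w + ρ ^ 2) = 1 - ρ ^ 2) (hy : (kmsMatrix n ρ).mulVec y = l • y)
    {j : ℤ} (h0 : 0 ≤ j) (h1 : j < n) :
    kmsExtension ρ y (j + 1) = 2 * w * kmsExtension ρ y j - kmsExtension ρ y (j - 1) := by
  lift j to ℕ using h0
  have hr := kmsExtension_recurrence ρ y ⟨j, by omega⟩
  have he := kmsExtension_of_eigenvector hy ⟨j, by omega⟩
  simp only at hr he
  apply mul_left_cancel₀ (mul_ne_zero hl hρ)
  linear_combination -l * hr + kmsExtension ρ y j * hw + (1 - ρ ^ 2) * he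

theorem exists_recurrence_coeff (hρ : ρ ≠ 0) (hl : l ≠ 0) :
    ∃ w : ℂ, l * (1 - 2 * ρ * w + ρ ^ 2) = 1 - ρ ^ 2 := by
  refine ⟨(1 + ρ ^ 2 - (1 - ρ ^ 2) / l) / (2 * ρ), ?_⟩
  field_simp
  ring

theorem kmsExtension_zero_ne_zero (hρ : ρ ≠ 0) (hl : l ≠ 0)
    (hy : (kmsMatrix n ρ).mulVec y = l • y) (hy0 : y ≠ 0) : kmsExtension ρ y 0 ≠ 0 := by
  intro h0
  obtain ⟨w, hw⟩ := exists_recurrence_coeff hρ hl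
  have key : ∀ j : ℕ, j ≤ n →
      kmsExtension ρ y ((j : ℤ) - 1) = 0 ∧ kmsExtension ρ y (j : ℤ) = 0 := by
    intro j
    induction j with
    | zero =>
      intro _
      have h1 := kmsExtension_neg_one ρ y
      rw [h0, mul_zero] at h1
      exact ⟨by simpa using h1, by simpa using h0⟩
    | succ j ih =>
      intro hj
      obtain ⟨h1, h2⟩ := ih (by omega)
      have h3 := kmsExtension_three_term hρ hl hw hy (j := j) (by omega) (by omega)
      rw [h1, h2] at h3
      push_cast
      exact ⟨by simpa using h2, by simpa using h3⟩
  refine hy0 (funext fun j => ?_)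
  have h1 := kmsExtension_of_eigenvector hy j
  rw [(key j j.2.le).2] at h1
  exact (mul_eq_zero.1 h1.symm).resolve_left hl

/-- The secular equation. A symmetric (skew-symmetric) solution `S` of the same recurrence as the
extended eigenvector `z` has vanishing Casoratian with it: the Casoratian is constant, and
reversal changes its sign. Since `z (-1) = ρ z 0 ≠ 0`, this gives `S (-1) = ρ S 0`. -/
theorem secular_equation (hρ : ρ ≠ 0) (hl : l ≠ 0)
    (hw : l * (1 - 2 * ρ * w + ρ ^ 2) = 1 - ρ ^ 2) (hy : (kmsMatrix n ρ).mulVec y = l • y)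
    (hy0 : y ≠ 0) {k : EigenType} (hk : HasSymmetry k y) {S : ℤ → ℂ}
    (hS : ∀ j, S (j + 1) = 2 * w * S j - S (j - 1)) (hSk : ∀ j, S (n - 1 - j) = k.sign * S j) :
    S (-1) = ρ * S 0 := by
  set z := kmsExtension ρ y with hz
  -- the Casoratian, taken at the indices `j - 1, j` for `0 ≤ j ≤ n`
  have hconst : ∀ j : ℕ, j ≤ n →
      z j * S (j - 1) - z (j - 1) * S j = z 0 * S (-1) - z (-1) * S 0 := by
    intro j
    induction j with
    | zero => intro _; simp
    | succ j ih =>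
      intro hj
      have h1 := kmsExtension_three_term hρ hl hw hy (j := j) (by omega) (by omega)
      rw [← ih (by omega)]
      push_cast
      rw [add_sub_cancel_right, hS j, ← hz] at *
      rw [h1]
      ring
  have h1 := hconst n le_rfl
  have hzr : ∀ j, z (n - 1 - j) = k.sign * z j := kmsExtension_rev ρ hk
  have e1 := hzr (-1)
  have e2 := hzr 0
  have e3 := hSk (-1)
  have e4 := hSk 0
  rw [sub_neg_eq_add, sub_add_cancel] at e1 e3
  rw [sub_zero] at e2 e4
  rw [e1, e2, e3, e4] at h1
  have h2 := kmsExtension_neg_one ρ y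
  rw [← hz] at h2
  apply mul_left_cancel₀ (kmsExtension_zero_ne_zero hρ hl hy hy0)
  rw [← hz]
  linear_combination (-2⁻¹ : ℂ) * h1 + S 0 * h2
    + 2⁻¹ * (z (-1) * S 0 - z 0 * S (-1)) * k.sign_sq

end Eigenvector

theorem isTypeEigenvalue_iff {n : ℕ} {k : EigenType} {ρ l : ℂ} :
    IsTypeEigenvalue n k ρ l ↔
      ∃ y : Fin n → ℂ, y ≠ 0 ∧ (kmsMatrix n ρ).mulVec y = l • y ∧ HasSymmetry k y := by
  simp only [IsTypeEigenvalue, Module.End.hasEigenvector_iff, Module.End.mem_eigenspace_iff,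
    Matrix.toLin'_apply]
  exact exists_congr fun y => by tauto

/-- For `ρ ≠ 0` the eigenspace of a nonzero eigenvalue is one-dimensional, because an eigenvector
is determined by its first entry; so it cannot contain vectors of both types. -/
theorem not_isTypeEigenvalue_both {n : ℕ} {ρ l : ℂ} (hρ : ρ ≠ 0) (hl : l ≠ 0)
    (h1 : IsTypeEigenvalue n .type1 ρ l) (h2 : IsTypeEigenvalue n .type2 ρ l) : False := by
  obtain ⟨y, hy0, hy, hys⟩ := isTypeEigenvalue_iff.1 h1
  obtain ⟨x, hx0, hx, hxs⟩ := isTypeEigenvalue_iff.1 h2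
  have hyz := kmsExtension_zero_ne_zero hρ hl hy hy0
  have hxz := kmsExtension_zero_ne_zero hρ hl hx hx0
  set a := kmsExtension ρ y 0 with ha
  set b := kmsExtension ρ x 0 with hb
  have hzero : b • y - a • x = 0 := by
    by_contra hne
    refine kmsExtension_zero_ne_zero hρ hl (y := b • y - a • x) ?_ hne ?_
    · rw [Matrix.mulVec_sub, Matrix.mulVec_smul, Matrix.mulVec_smul, hy, hx, smul_sub,
        smul_comm b, smul_comm a]
    · have : kmsExtension ρ (b • y - a • x) 0 = b * a - a * b := by
        rw [ha, hb]
        simp only [kmsExtension, Finset.mul_sum, ← Finset.sum_sub_distrib]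
        refine Finset.sum_congr rfl fun k _ => ?_
        simp only [Pi.sub_apply, Pi.smul_apply, smul_eq_mul]
        ring
      rw [this]; ring
  refine hy0 (funext fun j => ?_)
  have e1 := congrFun hzero j
  have e2 := congrFun hzero (Fin.rev j)
  have e3 := hys j
  have e4 := hxs j
  simp only [Pi.sub_apply, Pi.smul_apply, smul_eq_mul, Pi.zero_apply, e3, e4] at e1 e2 ⊢
  apply mul_left_cancel₀ hxz
  linear_combination 2⁻¹ * e1 - 2⁻¹ * e2

/-! ### Extraordinary eigenvalues as eigenvalues of the type blocks -/

theorem isTypeEigenvalue_of_mem_roots {n : ℕ} {k : EigenType} {ρ l : ℂ}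
    (hl : l ∈ (typeBlock k (kmsMatrix n ρ)).charpoly.roots) (hl1 : l ≠ 1) :
    IsTypeEigenvalue n k ρ l :=
  isTypeEigenvalue_iff.2 (exists_eigenvector_of_mem_roots_typeBlock (commute_kmsMatrix n ρ) hl hl1)

/-- The predicate singling out extraordinary eigenvalues. -/
def Large (n : ℕ) (l : ℂ) : Prop := (n : ℝ) < ‖l‖

theorem not_large_one {n : ℕ} (hn : 2 ≤ n) : ¬ Large n 1 := by
  have : (2 : ℝ) ≤ n := by exact_mod_cast hn
  simp only [Large, norm_one]
  linarith

theorem Large.ne_zero {n : ℕ} {l : ℂ} (h : Large n l) : l ≠ 0 := by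
  rintro rfl
  have : (n : ℝ) < 0 := by simpa [Large] using h
  exact absurd this (not_lt.2 n.cast_nonneg)

theorem Large.ne_one {n : ℕ} (hn : 2 ≤ n) {l : ℂ} (h : Large n l) : l ≠ 1 := by
  rintro rfl
  exact not_large_one hn h

open Classical in
theorem extraordinary_eq_add {n : ℕ} (hn : 2 ≤ n) (ρ : ℂ) :
    extraordinary n ρ =
      (typeBlock .type1 (kmsMatrix n ρ)).charpoly.roots.filter (Large n) +
        (typeBlock .type2 (kmsMatrix n ρ)).charpoly.roots.filter (Large n) := by
  rw [typeBlock_roots_filter (commute_kmsMatrix n ρ) _ (not_large_one hn)]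
  rfl

theorem eigenCount_kmsMatrix_zero {n : ℕ} (hn : 2 ≤ n) (k : EigenType) :
    eigenCount (Large n) (typeBlock k (kmsMatrix n 0)) = 0 := by
  classical
  rw [kmsMatrix_zero, typeBlock_one, eigenCount, Multiset.countP_eq_zero]
  intro a ha
  rw [Matrix.charpoly_one, ← Polynomial.C_1, Polynomial.roots_pow, Polynomial.roots_X_sub_C] at ha
  rw [Multiset.mem_singleton.1 (Multiset.mem_of_mem_nsmul ha)]
  exact not_large_one hn

open Classical in
/-- No extraordinary eigenvalue is of both types, so those of type `k` are exactly the large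
eigenvalues of the block of type `k`, with the same multiplicities. -/
theorem filter_extraordinary {n : ℕ} (hn : 2 ≤ n) (k : EigenType) (ρ : ℂ) :
    (extraordinary n ρ).filter (IsTypeEigenvalue n k ρ) =
      (typeBlock k (kmsMatrix n ρ)).charpoly.roots.filter (Large n) := by
  rcases eq_or_ne ρ 0 with rfl | hρ
  · have h0 : ∀ k, (typeBlock k (kmsMatrix n 0)).charpoly.roots.filter (Large n) = 0 := by
      intro k
      rw [← Multiset.card_eq_zero, ← Multiset.countP_eq_card_filter]
      exact eigenCount_kmsMatrix_zero hn k
    rw [extraordinary_eq_add hn, h0, h0, h0]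
    simp
  have hself : ∀ k, ((typeBlock k (kmsMatrix n ρ)).charpoly.roots.filter (Large n)).filter
      (IsTypeEigenvalue n k ρ) =
        (typeBlock k (kmsMatrix n ρ)).charpoly.roots.filter (Large n) := by
    intro k
    rw [Multiset.filter_eq_self]
    intro l hl
    rw [Multiset.mem_filter] at hl
    exact isTypeEigenvalue_of_mem_roots hl.1 (hl.2.ne_one hn)
  have hother : ∀ k k', k ≠ k' → ((typeBlock k (kmsMatrix n ρ)).charpoly.roots.filter
      (Large n)).filter (IsTypeEigenvalue n k' ρ) = 0 := by
    intro k k' hk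
    rw [Multiset.filter_eq_nil]
    intro l hl hl'
    rw [Multiset.mem_filter] at hl
    have h := isTypeEigenvalue_of_mem_roots hl.1 (hl.2.ne_one hn)
    cases k <;> cases k'
    · exact hk rfl
    · exact not_isTypeEigenvalue_both hρ hl.2.ne_zero h hl'
    · exact not_isTypeEigenvalue_both hρ hl.2.ne_zero hl' h
    · exact hk rfl
  rw [extraordinary_eq_add hn, Multiset.filter_add]
  cases k
  · rw [hself, hother _ _ (by simp), add_zero]
  · rw [hself, hother _ _ (by simp), zero_add]

theorem extraordinaryCount_eq_eigenCount {n : ℕ} (hn : 2 ≤ n) (k : EigenType) (ρ : ℂ) :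
    extraordinaryCount n k ρ = eigenCount (Large n) (typeBlock k (kmsMatrix n ρ)) := by
  classical
  rw [extraordinaryCount, filter_extraordinary hn, eigenCount, Multiset.countP_eq_card_filter]

theorem continuous_typeBlock {n : ℕ} (k : EigenType) :
    Continuous (typeBlock (n := n) k) := by
  unfold typeBlock
  exact (continuous_id.matrix_mul continuous_const).add continuous_const

/-! ### The inverse matrix and the behaviour for large `|ρ|` -/

/-- The tridiagonal inverse of `K_n(ρ)` as a function of `ε = ρ⁻¹`. -/
noncomputable def kmsInv (n : ℕ) (ε : ℂ) : Matrix (Fin n) (Fin n) ℂ :=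
  (ε ^ 2 - 1)⁻¹ • Matrix.of fun i j : Fin n =>
    (if (j : ℤ) = i then (1 + ε ^ 2 - (if (i : ℤ) = 0 then 1 else 0)
      - (if (i : ℤ) = n - 1 then 1 else 0)) else 0)
    - (if (j : ℤ) = i - 1 then ε else 0) - (if (j : ℤ) = i + 1 then ε else 0)

theorem commute_kmsInv (n : ℕ) (ε : ℂ) : Commute (kmsInv n ε) (revMatrix n) := by
  refine commute_revMatrix fun i j => ?_
  have hi := i.2
  have hj := j.2
  have e1 : ((Fin.rev j : ℕ) : ℤ) = (Fin.rev i : ℕ) ↔ (j : ℤ) = i := by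
    simp only [Fin.val_rev]; omega
  have e2 : ((Fin.rev i : ℕ) : ℤ) = 0 ↔ (i : ℤ) = n - 1 := by
    simp only [Fin.val_rev]; omega
  have e3 : ((Fin.rev i : ℕ) : ℤ) = n - 1 ↔ (i : ℤ) = 0 := by
    simp only [Fin.val_rev]; omega
  have e4 : ((Fin.rev j : ℕ) : ℤ) = (Fin.rev i : ℕ) - 1 ↔ (j : ℤ) = i + 1 := by
    simp only [Fin.val_rev]; omega
  have e5 : ((Fin.rev j : ℕ) : ℤ) = (Fin.rev i : ℕ) + 1 ↔ (j : ℤ) = i - 1 := by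
    simp only [Fin.val_rev]; omega
  simp only [kmsInv, Matrix.smul_apply, Matrix.of_apply, e1, e2, e3, e4, e5]
  congr 1
  split_ifs <;> ring

theorem sum_fin_ite_eq (n : ℕ) (c : ℤ) (a : ℂ) (g : ℤ → ℂ) :
    ∑ j : Fin n, (if (j : ℤ) = c then a else 0) * g j =
      if 0 ≤ c ∧ c < n then a * g c else 0 := by
  split_ifs with h
  · obtain ⟨h0, h1⟩ := h
    lift c to ℕ using h0
    rw [Finset.sum_eq_single (⟨c, by omega⟩ : Fin n)]
    · simp
    · intro b _ hb
      rw [if_neg, zero_mul]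
      intro h
      exact hb (Fin.ext (by simpa using h))
    · simp
  · refine Finset.sum_eq_zero fun j _ => ?_
    rw [if_neg, zero_mul]
    have := j.2
    omega

theorem kmsInv_mul_kmsMatrix (n : ℕ) {ρ : ℂ} (hρ : ρ ≠ 0) (hρ2 : ρ ^ 2 ≠ 1) :
    kmsInv n ρ⁻¹ * kmsMatrix n ρ = 1 := by
  have hd : (ρ⁻¹) ^ 2 - 1 ≠ 0 := by
    rw [sub_ne_zero, inv_pow, Ne, inv_eq_one]
    exact hρ2
  ext i k
  set g : ℤ → ℂ := fun j => ρ ^ (j - (k : ℤ)).natAbs with hg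
  have hK : ∀ j : Fin n, kmsMatrix n ρ j k = g j := fun j => rfl
  have hi := i.2
  have hk := k.2
  have hlo : (i : ℤ) = 0 → g (i - 1) = ρ * g i := by
    intro h
    simp only [hg, ← pow_succ']
    congr 1
    omega
  have hhi : (i : ℤ) = n - 1 → g (i + 1) = ρ * g i := by
    intro h
    simp only [hg, ← pow_succ']
    congr 1
    omega
  have hrec : (1 + ρ ^ 2) * g i - ρ * (g (i - 1) + g (i + 1)) =
      if i = k then 1 - ρ ^ 2 else 0 := by
    have h1 := pow_natAbs_recurrence ρ ((i : ℤ) - k)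
    have h2 : ((i : ℤ) - k = 0) ↔ i = k := by rw [Fin.ext_iff]; omega
    simp only [h2] at h1
    rw [← h1, hg]
    simp only [sub_right_comm, add_sub_right_comm]
  rw [kmsInv, Matrix.smul_mul, Matrix.smul_apply, Matrix.mul_apply, smul_eq_mul]
  simp only [Matrix.of_apply, hK, sub_mul, Finset.sum_sub_distrib, sum_fin_ite_eq]
  have hsum : (1 + ρ⁻¹ ^ 2) * g i - ρ⁻¹ * (g (i - 1) + g (i + 1)) =
      (ρ⁻¹ ^ 2 - 1) * (1 : Matrix (Fin n) (Fin n) ℂ) i k := by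
    have : (1 : Matrix (Fin n) (Fin n) ℂ) i k * (1 - ρ ^ 2) = if i = k then 1 - ρ ^ 2 else 0 := by
      rw [Matrix.one_apply]; split_ifs <;> simp
    rw [← this] at hrec
    field_simp
    linear_combination hrec
  rw [inv_mul_eq_iff_eq_mul₀ hd, ← hsum, if_pos (by omega)]
  have c1 : (0 ≤ (i : ℤ) - 1 ∧ (i : ℤ) - 1 < n) ↔ ¬ (i : ℤ) = 0 := by omega
  have c2 : (0 ≤ (i : ℤ) + 1 ∧ (i : ℤ) + 1 < n) ↔ ¬ (i : ℤ) = n - 1 := by omega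
  simp only [c1, c2]
  have hr : ρ⁻¹ * ρ = 1 := inv_mul_cancel₀ hρ
  split_ifs with a b b
  · linear_combination ρ⁻¹ * hlo a + ρ⁻¹ * hhi b + 2 * g i * hr
  · linear_combination ρ⁻¹ * hlo a + g i * hr
  · linear_combination ρ⁻¹ * hhi b + g i * hr
  · ring

theorem continuousAt_kmsInv_zero (n : ℕ) : ContinuousAt (kmsInv n) 0 := by
  have h : ContinuousAt (fun ε : ℂ => (ε ^ 2 - 1)⁻¹) 0 :=
    ContinuousAt.inv₀ (by fun_prop) (by simp)
  refine h.smul (Continuous.continuousAt (continuous_matrix fun i j => ?_))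
  simp only [Matrix.of_apply]
  split_ifs <;> fun_prop

theorem kmsInv_zero {n : ℕ} (hn : 2 ≤ n) :
    kmsInv n 0 = Matrix.diagonal fun i : Fin n =>
      if (i : ℕ) = 0 ∨ (i : ℕ) + 1 = n then (0 : ℂ) else -1 := by
  ext i j
  have hi := i.2
  have c1 : (i : ℤ) = n - 1 ↔ (i : ℕ) + 1 = n := by omega
  have c2 : (j : ℤ) = i ↔ i = j := by rw [Fin.ext_iff]; omega
  simp only [kmsInv, Matrix.smul_apply, Matrix.of_apply, Matrix.diagonal_apply, c1, c2]
  by_cases h : i = j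
  · subst h
    by_cases h0 : (i : ℕ) = 0
    · have : ¬ (0 + 1 = n) := by omega
      simp [h0, this]
    · by_cases h1 : (i : ℕ) + 1 = n
      · simp [h0, h1]
      · simp [h0, h1]
  · simp [h]

/-- At `ε = 0` exactly two eigenvalues of the inverse lie in the disk `|z| < 1/n`. -/
theorem eigenCount_kmsInv_zero {n : ℕ} (hn : 2 ≤ n) :
    eigenCount (fun z => ‖z‖ < (n : ℝ)⁻¹) (kmsInv n 0) = 2 := by
  classical
  have hn' : (0 : ℝ) < (n : ℝ)⁻¹ := by
    have : 0 < n := by omega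
    positivity
  have hn1 : ¬ ((1 : ℝ) < (n : ℝ)⁻¹) := by
    rw [not_lt]
    exact inv_le_one_of_one_le₀ (by exact_mod_cast (by omega : 1 ≤ n))
  have hroots := charpoly_roots_of_eval (kmsInv n 0)
    (fun i : Fin n => if (i : ℕ) = 0 ∨ (i : ℕ) + 1 = n then (0 : ℂ) else -1) (fun z _ => by
      rw [kmsInv_zero hn, Matrix.charpoly_diagonal, Polynomial.eval_prod]
      simp)
  rw [eigenCount_eq_card _ _ hroots]
  have : (Finset.univ.filter fun i : Fin n =>
      ‖(if (i : ℕ) = 0 ∨ (i : ℕ) + 1 = n then (0 : ℂ) else -1)‖ < (n : ℝ)⁻¹) =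
      {⟨0, by omega⟩, ⟨n - 1, by omega⟩} := by
    ext i
    simp only [Finset.mem_filter, Finset.mem_univ, true_and, Finset.mem_insert,
      Finset.mem_singleton, Fin.ext_iff]
    split_ifs with h
    · simp only [norm_zero, hn', true_iff]; omega
    · simp only [norm_neg, norm_one, hn1, false_iff]; omega
  rw [this, Finset.card_pair]
  simp only [Ne, Fin.ext_iff]
  omega

/-- The vector `e₁ ± eₙ` of type `k` is annihilated by the limit matrix. -/
theorem det_typeBlock_kmsInv_zero {n : ℕ} (hn : 2 ≤ n) (k : EigenType) :
    (typeBlock k (kmsInv n 0)).det = 0 := by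
  rw [← Matrix.exists_mulVec_eq_zero_iff]
  refine ⟨fun i => (if (i : ℕ) = 0 then 1 else 0) + if (i : ℕ) + 1 = n then k.sign else 0,
    ?_, ?_⟩
  · intro h
    have h0 := congrFun h ⟨0, by omega⟩
    have : ¬ (0 + 1 = n) := by omega
    simp [this] at h0
  · rw [typeBlock, Matrix.add_mulVec, ← Matrix.mulVec_mulVec, Matrix.sub_mulVec,
      Matrix.one_mulVec, typeProj_mulVec, sub_self, add_zero, kmsInv_zero hn]
    · ext i
      rw [Matrix.mulVec_diagonal]
      split_ifs with h1 h2 h3 h4 <;> simp_all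
    · rw [hasSymmetry_iff]
      intro j
      have hj := j.2
      have c1 : (Fin.rev j : ℕ) = 0 ↔ (j : ℕ) + 1 = n := by rw [Fin.val_rev]; omega
      have c2 : (Fin.rev j : ℕ) + 1 = n ↔ (j : ℕ) = 0 := by rw [Fin.val_rev]; omega
      simp only [c1, c2, mul_add, mul_ite, mul_one, mul_zero, k.sign_sq]
      rw [add_comm]

theorem eigenCount_typeBlock_kmsInv_zero {n : ℕ} (hn : 2 ≤ n) (k : EigenType) :
    eigenCount (fun z => ‖z‖ < (n : ℝ)⁻¹) (typeBlock k (kmsInv n 0)) = 1 := by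
  classical
  have hn' : (0 : ℝ) < (n : ℝ)⁻¹ := by
    have : 0 < n := by omega
    positivity
  have hpos : ∀ k, 0 < eigenCount (fun z => ‖z‖ < (n : ℝ)⁻¹) (typeBlock k (kmsInv n 0)) := by
    intro k
    rw [eigenCount, Multiset.countP_pos]
    refine ⟨0, ?_, by simpa using hn'⟩
    rw [Polynomial.mem_roots (Matrix.charpoly_monic _).ne_zero, Polynomial.IsRoot,
      Matrix.eval_charpoly]
    have : Fintype.card (Fin n) ≠ 0 := by simp; omega
    simp [Matrix.det_neg, det_typeBlock_kmsInv_zero hn]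
  have hadd := eigenCount_typeBlock_add (commute_kmsInv n 0) (fun z => ‖z‖ < (n : ℝ)⁻¹) (by
    rw [norm_one, not_lt]
    exact inv_le_one_of_one_le₀ (by exact_mod_cast (by omega : 1 ≤ n)))
  rw [eigenCount_kmsInv_zero hn] at hadd
  have h1 := hpos .type1
  have h2 := hpos .type2
  cases k <;> omega

theorem norm_ne_of_mem_roots_kmsInv_zero {n : ℕ} (hn : 2 ≤ n) (k : EigenType) {z : ℂ}
    (hz : z ∈ (typeBlock k (kmsInv n 0)).charpoly.roots) : ‖z‖ ≠ (n : ℝ)⁻¹ := by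
  have hn0 : (0 : ℝ) < n := by exact_mod_cast (by omega : 0 < n)
  have hn1 : (n : ℝ)⁻¹ < 1 := inv_lt_one_of_one_lt₀ (by exact_mod_cast (by omega : 1 < n))
  rcases eq_or_ne z 1 with rfl | hz1
  · rw [norm_one]; exact hn1.ne'
  obtain ⟨y, hy0, hy, -⟩ := exists_eigenvector_of_mem_roots_typeBlock (commute_kmsInv n 0) hz hz1
  obtain ⟨i, hi⟩ := Function.ne_iff.1 hy0
  have h := congrFun hy i
  rw [kmsInv_zero hn, Matrix.mulVec_diagonal, Pi.smul_apply, smul_eq_mul] at h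
  rw [← mul_right_cancel₀ hi h]
  split_ifs
  · rw [norm_zero]; positivity
  · rw [norm_neg, norm_one]; exact hn1.ne'

theorem exists_extraordinaryCount_eq_one {n : ℕ} (hn : 2 ≤ n) :
    ∃ R : ℝ, ∀ ρ : ℂ, R < ‖ρ‖ → ∀ k, extraordinaryCount n k ρ = 1 := by
  have hk : ∀ k, ∀ᶠ ε in 𝓝 (0 : ℂ),
      eigenCount (fun z => ‖z‖ < (n : ℝ)⁻¹) (typeBlock k (kmsInv n ε)) = 1 := by
    intro k
    rw [← eigenCount_typeBlock_kmsInv_zero hn k]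
    refine eventually_eigenCount_eq (F := fun ε => typeBlock k (kmsInv n ε))
      ((continuous_typeBlock k).continuousAt.comp (continuousAt_kmsInv_zero n)) _ fun r hr => ?_
    rcases (norm_ne_of_mem_roots_kmsInv_zero hn k hr).lt_or_gt with h | h
    · filter_upwards [continuous_norm.continuousAt.eventually_lt_const h] with z hz
      exact iff_of_true hz h
    · filter_upwards [continuous_norm.continuousAt.eventually_const_lt h] with z hz
      exact iff_of_false hz.not_gt h.not_gt
  obtain ⟨δ, hδ, hball⟩ := Metric.eventually_nhds_iff.1 ((hk .type1).and (hk .type2))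
  refine ⟨max 1 δ⁻¹, fun ρ hρ k => ?_⟩
  have h1 : 1 < ‖ρ‖ := (le_max_left _ _).trans_lt hρ
  have h2 : δ⁻¹ < ‖ρ‖ := (le_max_right _ _).trans_lt hρ
  have hρ0 : ρ ≠ 0 := by
    rintro rfl
    rw [norm_zero] at h1
    linarith
  have hρ2 : ρ ^ 2 ≠ 1 := by
    intro h
    have := congrArg norm h
    rw [norm_pow, norm_one] at this
    nlinarith
  have hdist : dist ρ⁻¹ 0 < δ := by
    rw [dist_zero_right, norm_inv]
    exact inv_lt_of_inv_lt₀ hδ h2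
  have hcount : eigenCount (fun z => ‖z‖ < (n : ℝ)⁻¹) (typeBlock k (kmsInv n ρ⁻¹)) = 1 := by
    cases k
    · exact (hball hdist).1
    · exact (hball hdist).2
  have hinv : typeBlock k (kmsInv n ρ⁻¹) * typeBlock k (kmsMatrix n ρ) = 1 := by
    rw [typeBlock_mul k _ (commute_kmsMatrix n ρ), kmsInv_mul_kmsMatrix n hρ0 hρ2, typeBlock_one]
  rw [extraordinaryCount_eq_eigenCount hn, eigenCount_of_mul_eq_one _ hinv]
  rw [← hcount]
  classical
  refine Multiset.countP_congr rfl fun z hz => ?_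
  -- `0` has to be excluded because of the convention `0⁻¹ = 0`
  have hz0 : z ≠ 0 := by
    rintro rfl
    have h0 := Polynomial.isRoot_of_mem_roots hz
    rw [Polynomial.IsRoot, Matrix.eval_charpoly, map_zero, zero_sub] at h0
    have h3 := congrArg Matrix.det hinv
    rw [Matrix.det_mul, Matrix.det_one, ← neg_neg (typeBlock k (kmsInv n ρ⁻¹)), Matrix.det_neg, h0,
      mul_zero, zero_mul] at h3
    exact zero_ne_one h3
  have hn0 : (0 : ℝ) < n := by exact_mod_cast (by omega : 0 < n)
  rw [Large, norm_inv, lt_inv_comm₀ hn0 (norm_pos_iff.2 hz0)]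

/-! ### The functions `v(n,u)` and `μ(n,u)` -/

theorem normSq_sin_add_mul_I (x y : ℝ) :
    ‖Complex.sin (x + y * Complex.I)‖ ^ 2 = Real.sin x ^ 2 + Real.sinh y ^ 2 := by
  rw [Complex.sin_add_mul_I, ← Complex.ofReal_sin, ← Complex.ofReal_cos, ← Complex.ofReal_sinh,
    ← Complex.ofReal_cosh, ← Complex.normSq_eq_norm_sq, ← Complex.ofReal_mul, ← Complex.ofReal_mul,
    Complex.normSq_add_mul_I]
  have h1 := Real.cosh_sq y
  have h2 := Real.sin_sq_add_cos_sq x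
  linear_combination Real.sin x ^ 2 * h1 + Real.sinh y ^ 2 * h2

/-- The equation defining `v(n,u)` says that `sin (n μ) / sin μ` has modulus `n`. -/
theorem norm_sin_nat_mul_eq_iff (n : ℕ) (u v : ℝ) :
    ‖Complex.sin (n * (u + v * Complex.I))‖ = n * ‖Complex.sin (u + v * Complex.I)‖ ↔
      hFun n v = gFun n u := by
  rw [← sq_eq_sq₀ (norm_nonneg _) (by positivity), mul_pow, normSq_sin_add_mul_I,
    show (n : ℂ) * (u + v * Complex.I) = ((n * u : ℝ) : ℂ) + ((n * v : ℝ) : ℂ) * Complex.I by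
      push_cast; ring, normSq_sin_add_mul_I, hFun, gFun]
  constructor <;> intro h <;> linear_combination h

theorem sin_add_mul_I_eq_zero {u v : ℝ} (h : Complex.sin (u + v * Complex.I) = 0) :
    Real.sin u = 0 ∧ v = 0 := by
  have h1 := normSq_sin_add_mul_I u v
  rw [h, norm_zero] at h1
  have h2 : Real.sin u ^ 2 = 0 := by nlinarith [sq_nonneg (Real.sin u), sq_nonneg (Real.sinh v)]
  have h3 : Real.sinh v ^ 2 = 0 := by nlinarith [sq_nonneg (Real.sin u), sq_nonneg (Real.sinh v)]
  exact ⟨pow_eq_zero_iff two_ne_zero |>.1 h2,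
    Real.sinh_eq_zero.1 (pow_eq_zero_iff two_ne_zero |>.1 h3)⟩

theorem vFun_eq {n : ℕ} (hn : 2 ≤ n) {u v : ℝ} (hv : 0 ≤ v) (h : hFun n v = gFun n u) :
    vFun n u = v :=
  (existsUnique_v hn u).unique (vFun_spec hn u) ⟨hv, h⟩

theorem hFun_zero (n : ℕ) : hFun n 0 = 0 := by simp [hFun]

theorem gFun_of_sin_eq_zero (n : ℕ) {u : ℝ} (hu : Real.sin u = 0) : gFun n u = 0 := by
  have h := abs_sin_nat_mul_le n u
  rw [hu, abs_zero, mul_zero, abs_nonpos_iff] at h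
  simp [gFun, hu, h]

theorem sin_eq_zero_of_gFun_eq_zero {n : ℕ} (hn : 2 ≤ n) {u : ℝ} (h : gFun n u = 0) :
    Real.sin u = 0 := by
  obtain ⟨m, rfl⟩ : ∃ m, n = m + 1 := ⟨n - 1, by omega⟩
  have hm : (1 : ℝ) ≤ m := by exact_mod_cast (by omega : 1 ≤ m)
  by_contra hs
  have hs' := abs_pos.2 hs
  have h1 : |Real.sin ((m + 1 : ℕ) * u)| = (m + 1 : ℕ) * |Real.sin u| := by
    rw [← sq_eq_sq₀ (abs_nonneg _) (by positivity), mul_pow, sq_abs, sq_abs]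
    rw [gFun] at h
    linarith
  have h2 : |Real.sin ((m + 1 : ℕ) * u)| ≤ m * |Real.sin u| * |Real.cos u| + |Real.sin u| := by
    rw [show ((m + 1 : ℕ) : ℝ) * u = m * u + u by push_cast; ring, Real.sin_add]
    refine (abs_add_le _ _).trans ?_
    rw [abs_mul, abs_mul]
    have a1 := mul_le_mul_of_nonneg_right (abs_sin_nat_mul_le m u) (abs_nonneg (Real.cos u))
    have a2 := mul_le_mul_of_nonneg_right (Real.abs_cos_le_one (m * u)) (abs_nonneg (Real.sin u))
    linarith
  rw [h1] at h2
  push_cast at h2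
  have h3 : 1 ≤ |Real.cos u| := by
    have : m * |Real.sin u| * 1 ≤ m * |Real.sin u| * |Real.cos u| := by linarith
    exact le_of_mul_le_mul_left this (by positivity)
  have h4 := Real.sin_sq_add_cos_sq u
  have h5 := sq_abs (Real.cos u)
  have h6 : 0 < Real.sin u ^ 2 := by positivity
  nlinarith

theorem vFun_eq_zero_iff {n : ℕ} (hn : 2 ≤ n) {u : ℝ} : vFun n u = 0 ↔ Real.sin u = 0 := by
  constructor
  · intro h
    have h1 := (vFun_spec hn u).2
    rw [h, hFun_zero] at h1
    exact sin_eq_zero_of_gFun_eq_zero hn h1.symm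
  · intro h
    exact vFun_eq hn le_rfl (by rw [hFun_zero, gFun_of_sin_eq_zero n h])

theorem vFun_le_one {n : ℕ} (hn : 2 ≤ n) (u : ℝ) : vFun n u ≤ 1 := by
  obtain ⟨hv, h⟩ := vFun_spec hn u
  set v := vFun n u
  by_contra! hlt
  have hn0 : (0 : ℝ) < n := by exact_mod_cast (by omega : 0 < n)
  have h1 := pow_le_pow_left₀
    (by have := Real.sinh_nonneg_iff.2 hv; have := Real.cosh_pos v; positivity)
    (mul_sinh_mul_cosh_le hn hv) 2
  have h2 := Real.cosh_sq v
  have h3 : 1 < Real.sinh v := hlt.trans_le (Real.self_le_sinh_iff.2 hv)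
  have h4 : gFun n u ≤ (n : ℝ) ^ 2 := by
    have a1 := Real.sin_sq_le_one u
    have a2 := sq_nonneg (Real.sin (n * u))
    have a3 : (n : ℝ) ^ 2 * Real.sin u ^ 2 ≤ (n : ℝ) ^ 2 * 1 := by gcongr
    rw [gFun]
    linarith
  have h5 : (n : ℝ) ^ 2 * (Real.sinh v ^ 2 * Real.sinh v ^ 2) ≤ hFun n v := by
    rw [mul_pow, mul_pow, h2] at h1
    rw [hFun]
    linarith
  have h6 : 1 < Real.sinh v ^ 2 * Real.sinh v ^ 2 :=
    one_lt_mul_of_lt_of_le (by nlinarith) (by nlinarith)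
  have h7 : (n : ℝ) ^ 2 * 1 < (n : ℝ) ^ 2 * (Real.sinh v ^ 2 * Real.sinh v ^ 2) := by gcongr
  linarith

theorem eq_zero_or_pi_of_sin_eq_zero {u : ℝ} (hu : u ∈ Set.Icc (-Real.pi) Real.pi)
    (h : Real.sin u = 0) : u = 0 ∨ u = Real.pi ∨ u = -Real.pi := by
  obtain ⟨h1, h2⟩ := hu
  rcases h1.eq_or_lt with h1 | h1
  · exact Or.inr (Or.inr h1.symm)
  rcases h2.eq_or_lt with h2 | h2
  · exact Or.inr (Or.inl h2)
  exact Or.inl ((Real.sin_eq_zero_iff_of_lt_of_lt h1 h2).1 h)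

theorem muFun_of_sin_eq_zero {n : ℕ} (hn : 2 ≤ n) {u : ℝ} (h : Real.sin u = 0) :
    muFun n u = u := by
  rw [muFun, (vFun_eq_zero_iff hn).2 h]
  simp

/-! ### The parametrization of the borderline curves -/

/-- The sine for type 1 and the cosine for type 2. -/
noncomputable def trig : EigenType → ℂ → ℂ
  | .type1 => Complex.sin
  | .type2 => Complex.cos

theorem im_eq_zero_of_trig_eq_zero {k : EigenType} {z : ℂ} (h : trig k z = 0) : z.im = 0 := by
  cases k
  · obtain ⟨m, rfl⟩ := Complex.sin_eq_zero_iff.1 h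
    simp
  · obtain ⟨m, rfl⟩ := Complex.cos_eq_zero_iff.1 h
    have : (2 * (m : ℂ) + 1) * Real.pi / 2 = (((2 * m + 1) * Real.pi / 2 : ℝ) : ℂ) := by
      push_cast; ring
    rw [this, Complex.ofReal_im]

theorem trig_mul_muFun_ne_zero {n : ℕ} (hn : 2 ≤ n) (k : EigenType) {u : ℝ} (hu : Real.sin u ≠ 0)
    {c : ℝ} (hc : c ≠ 0) : trig k (c * muFun n u) ≠ 0 := by
  intro h
  have h1 := im_eq_zero_of_trig_eq_zero h
  have h2 : ((c : ℂ) * muFun n u).im = c * vFun n u := by simp [muFun]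
  rw [h2] at h1
  exact hu ((vFun_eq_zero_iff hn).1 ((mul_eq_zero.1 h1).resolve_left hc))

/-- The points `±π` are exceptional for type `k` exactly when `k.sign = (-1) ^ n`. At the others,
sine or cosine is evaluated at an integer or half-integer multiple of `π` where it does not vanish.
-/
theorem trig_ne_zero_at_pi {n : ℕ} {k : EigenType} (hk : k.sign ≠ (-1) ^ n)
    {z : ℂ} (hz : z = Real.pi ∨ z = -Real.pi) :
    trig k (((n : ℂ) + 1) * z / 2) ≠ 0 ∧ trig k (((n : ℂ) - 1) * z / 2) ≠ 0 := by
  have hpi : (Real.pi : ℂ) ≠ 0 := by exact_mod_cast Real.pi_ne_zero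
  cases k
  · have he : Even n := by
      by_contra ho
      rw [Nat.not_even_iff_odd] at ho
      exact hk (by rw [ho.neg_one_pow]; rfl)
    obtain ⟨m, rfl⟩ := he
    constructor <;> intro h <;> obtain ⟨j, hj⟩ := Complex.sin_eq_zero_iff.1 h <;>
      rcases hz with rfl | rfl
    · have : (2 * (m : ℂ) + 1) = 2 * j := by
        apply mul_right_cancel₀ hpi; push_cast at hj; linear_combination 2 * hj
      have h2 : (2 * (m : ℤ) + 1) = 2 * j := by exact_mod_cast this
      omega
    · have : (2 * (m : ℂ) + 1) = -(2 * j) := by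
        apply mul_right_cancel₀ hpi; push_cast at hj; linear_combination -2 * hj
      have h2 : (2 * (m : ℤ) + 1) = -(2 * j) := by exact_mod_cast this
      omega
    · have : (2 * (m : ℂ) - 1) = 2 * j := by
        apply mul_right_cancel₀ hpi; push_cast at hj; linear_combination 2 * hj
      have h2 : (2 * (m : ℤ) - 1) = 2 * j := by exact_mod_cast this
      omega
    · have : (2 * (m : ℂ) - 1) = -(2 * j) := by
        apply mul_right_cancel₀ hpi; push_cast at hj; linear_combination -2 * hj
      have h2 : (2 * (m : ℤ) - 1) = -(2 * j) := by exact_mod_cast this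
      omega
  · have he : Odd n := by
      by_contra ho
      rw [Nat.not_odd_iff_even] at ho
      exact hk (by rw [ho.neg_one_pow]; rfl)
    obtain ⟨m, rfl⟩ := he
    constructor <;> intro h <;> obtain ⟨j, hj⟩ := Complex.cos_eq_zero_iff.1 h <;>
      rcases hz with rfl | rfl
    · have : (2 * (m : ℂ) + 2) = 2 * j + 1 := by
        apply mul_right_cancel₀ hpi; push_cast at hj; linear_combination 2 * hj
      have h2 : (2 * (m : ℤ) + 2) = 2 * j + 1 := by exact_mod_cast this
      omega
    · have : (2 * (m : ℂ) + 2) = -(2 * j + 1) := by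
        apply mul_right_cancel₀ hpi; push_cast at hj; linear_combination -2 * hj
      have h2 : (2 * (m : ℤ) + 2) = -(2 * j + 1) := by exact_mod_cast this
      omega
    · have : (2 * (m : ℂ)) = 2 * j + 1 := by
        apply mul_right_cancel₀ hpi; push_cast at hj; linear_combination 2 * hj
      have h2 : (2 * (m : ℤ)) = 2 * j + 1 := by exact_mod_cast this
      omega
    · have : (2 * (m : ℂ)) = -(2 * j + 1) := by
        apply mul_right_cancel₀ hpi; push_cast at hj; linear_combination -2 * hj
      have h2 : (2 * (m : ℤ)) = -(2 * j + 1) := by exact_mod_cast this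
      omega

theorem sign_eq_neg_one_pow_iff (n : ℕ) (k : EigenType) :
    k.sign = (-1) ^ n ↔ match k with
      | .type1 => Odd n
      | .type2 => Even n := by
  rcases n.even_or_odd with h | h
  · rw [h.neg_one_pow]
    cases k
    · simp only [EigenType.sign, Nat.not_odd_iff_even.2 h, iff_false]; norm_num
    · simp [EigenType.sign, h]
  · rw [h.neg_one_pow]
    cases k
    · simp [EigenType.sign, h]
    · simp only [EigenType.sign, Nat.not_even_iff_odd.2 h, iff_false]; norm_num

/-- Outside the exceptional points, both terms of the quotient that defines `f_n^{(k)}` are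
nonzero; in particular the value is never produced by a division by zero. -/
theorem fFun_cases {n : ℕ} (hn : 2 ≤ n) (k : EigenType) {u : ℝ}
    (hu : u ∈ Set.Icc (-Real.pi) Real.pi) :
    (k = .type1 ∧ u = 0 ∧ fFun n k u = xi n) ∨
    ((u = Real.pi ∨ u = -Real.pi) ∧ k.sign = (-1) ^ n ∧ fFun n k u = -xi n) ∨
    (fFun n k u = trig k (((n : ℂ) + 1) * muFun n u / 2) / trig k (((n : ℂ) - 1) * muFun n u / 2) ∧
      trig k (((n : ℂ) + 1) * muFun n u / 2) ≠ 0 ∧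
      trig k (((n : ℂ) - 1) * muFun n u / 2) ≠ 0) := by
  have hpi := Real.pi_pos
  by_cases h0 : k = .type1 ∧ u = 0
  · obtain ⟨rfl, rfl⟩ := h0
    exact Or.inl ⟨rfl, rfl, by simp [fFun]⟩
  by_cases h1 : (u = Real.pi ∨ u = -Real.pi) ∧ k.sign = (-1) ^ n
  · refine Or.inr (Or.inl ⟨h1.1, h1.2, ?_⟩)
    have h2 := (sign_eq_neg_one_pow_iff n k).1 h1.2
    have hu0 : u ≠ 0 := by rintro rfl; rcases h1.1 with h | h <;> linarith
    cases k
    · simp only at h2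
      simp [fFun, hu0, h1.1, h2]
    · simp only at h2
      simp [fFun, h1.1, h2]
  refine Or.inr (Or.inr ⟨?_, ?_⟩)
  · rw [sign_eq_neg_one_pow_iff] at h1
    cases k
    · have hu0 : u ≠ 0 := by simpa using h0
      simp only at h1
      simp only [fFun, if_neg hu0, if_neg h1, trig]
    · simp only at h1
      simp only [fFun, if_neg h1, trig]
  · by_cases hs : Real.sin u = 0
    · rw [muFun_of_sin_eq_zero hn hs]
      rcases eq_zero_or_pi_of_sin_eq_zero hu hs with h | h
      · subst h
        cases k
        · simp at h0
        · simp [trig]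
      · have hk : k.sign ≠ (-1) ^ n := fun hk => h1 ⟨h, hk⟩
        refine trig_ne_zero_at_pi hk ?_
        rcases h with rfl | rfl
        · exact Or.inl rfl
        · exact Or.inr (by simp)
    · have hn1 : (2 : ℝ) ≤ n := by exact_mod_cast hn
      have a := trig_mul_muFun_ne_zero hn k hs (c := (n + 1) / 2) (by positivity)
      have b := trig_mul_muFun_ne_zero hn k hs (c := (n - 1) / 2) (by linarith)
      push_cast at a b
      rw [div_mul_eq_mul_div] at a b
      exact ⟨a, b⟩

theorem xi_ne_zero {n : ℕ} (hn : 2 ≤ n) : xi n ≠ 0 := by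
  refine div_ne_zero (by exact_mod_cast Nat.succ_ne_zero n) (sub_ne_zero.2 ?_)
  exact_mod_cast (by omega : n ≠ 1)

theorem zero_notMem_borderlineCurve {n : ℕ} (hn : 2 ≤ n) (k : EigenType) :
    (0 : ℂ) ∉ borderlineCurve n k := by
  rintro ⟨u, hu, h⟩
  rcases fFun_cases hn k hu with ⟨-, -, h1⟩ | ⟨-, -, h1⟩ | ⟨h1, h2, h3⟩
  · exact xi_ne_zero hn (h1.symm.trans h)
  · exact xi_ne_zero hn (neg_eq_zero.1 (h1.symm.trans h))
  · exact div_ne_zero h2 h3 (h1.symm.trans h)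

/-! ### The borderline curves are bounded -/

/-- Here `A = ρ a` is a sine or cosine of `(n+1)μ/2`, `a` that of `(n-1)μ/2`, and `B`, `b` are their
companions. If `‖ρ‖ > 6 C`, then `‖a‖ < 1/6`, hence `‖b‖ ≥ 1/2`, whereas the balance condition gives
`(n-1) ‖ρ b‖ ≤ (n+1) C ≤ 3 (n-1) C`. -/
theorem norm_le_of_balanced {n : ℕ} (hn : 2 ≤ n) {ρ a b A B : ℂ} {C : ℝ} (hA : A = ρ * a)
    (hAC : ‖A‖ ≤ C) (hBC : ‖B‖ ≤ C) (hab : a ^ 2 + b ^ 2 = 1)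
    (h : ‖ρ * b + B‖ = n * ‖ρ * b - B‖) : ‖ρ‖ ≤ 6 * C := by
  by_contra! hlt
  have hC : 0 ≤ C := (norm_nonneg _).trans hAC
  have hρ : 0 < ‖ρ‖ := by linarith
  have hn1 : (2 : ℝ) ≤ n := by exact_mod_cast hn
  have ha : ‖a‖ < 1 / 6 := by
    rw [hA, norm_mul] at hAC
    have : ‖ρ‖ * ‖a‖ < ‖ρ‖ * (1 / 6) := by linarith
    exact lt_of_mul_lt_mul_left this hρ.le
  have hb : 1 / 2 ≤ ‖b‖ := by
    have h1 : (1 : ℝ) ≤ ‖a‖ ^ 2 + ‖b‖ ^ 2 := by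
      rw [← norm_pow, ← norm_pow, ← norm_one (α := ℂ), ← hab]
      exact norm_add_le _ _
    have h2 := norm_nonneg a
    have h3 := norm_nonneg b
    nlinarith
  have h1 : ‖ρ * b + B‖ ≤ ‖ρ‖ * ‖b‖ + C := by
    refine (norm_add_le _ _).trans ?_
    rw [norm_mul]
    linarith
  have h2 : ‖ρ‖ * ‖b‖ - C ≤ ‖ρ * b - B‖ := by
    have := norm_sub_norm_le (ρ * b) B
    rw [norm_mul] at this
    linarith
  have h3 : n * (‖ρ‖ * ‖b‖ - C) ≤ ‖ρ‖ * ‖b‖ + C := by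
    refine le_trans ?_ h1
    rw [h]
    exact mul_le_mul_of_nonneg_left h2 (by positivity)
  have h4 : 3 * C < ‖ρ‖ * ‖b‖ := by nlinarith
  nlinarith

theorem norm_sin_muFun {n : ℕ} (hn : 2 ≤ n) (u : ℝ) :
    ‖Complex.sin (n * muFun n u)‖ = n * ‖Complex.sin (muFun n u)‖ :=
  (norm_sin_nat_mul_eq_iff n u _).2 (vFun_spec hn u).2

theorem sin_cos_half_identities (n : ℕ) (μ : ℂ) :
    Complex.sin (n * μ) = Complex.sin (((n : ℂ) + 1) * μ / 2) * Complex.cos (((n : ℂ) - 1) * μ / 2)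
      + Complex.cos (((n : ℂ) + 1) * μ / 2) * Complex.sin (((n : ℂ) - 1) * μ / 2) ∧
    Complex.sin μ = Complex.sin (((n : ℂ) + 1) * μ / 2) * Complex.cos (((n : ℂ) - 1) * μ / 2)
      - Complex.cos (((n : ℂ) + 1) * μ / 2) * Complex.sin (((n : ℂ) - 1) * μ / 2) := by
  rw [← Complex.sin_add, ← Complex.sin_sub]
  constructor <;> congr 1 <;> ring

/-- If `|ρ|` is large at a point of the curve, then the denominator of `f_n^{(k)}` is small, so its
companion (cosine for sine, and conversely) is not; but `|sin (n μ)| = n |sin μ|` bounds the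
product of `ρ` with this companion. -/
theorem exists_bound_borderlineCurve {n : ℕ} (hn : 2 ≤ n) :
    ∃ R : ℝ, ∀ k, ∀ ρ ∈ borderlineCurve n k, ‖ρ‖ ≤ R := by
  have hcpt : IsCompact (Set.Icc (-Real.pi) Real.pi ×ℂ Set.Icc (0 : ℝ) 1) :=
    isCompact_Icc.reProdIm isCompact_Icc
  obtain ⟨C, hC⟩ := hcpt.exists_bound_of_continuousOn (f := fun μ : ℂ =>
    (Complex.sin (((n : ℂ) + 1) * μ / 2), Complex.cos (((n : ℂ) + 1) * μ / 2)))
    (by fun_prop)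
  refine ⟨max ‖xi n‖ (6 * C), ?_⟩
  rintro k _ ⟨u, hu, rfl⟩
  rcases fFun_cases hn k hu with ⟨-, -, h1⟩ | ⟨-, -, h1⟩ | ⟨h1, h2, h3⟩
  · rw [h1]; exact le_max_left _ _
  · rw [h1, norm_neg]; exact le_max_left _ _
  · refine le_trans ?_ (le_max_right _ _)
    have hμ : muFun n u ∈ Set.Icc (-Real.pi) Real.pi ×ℂ Set.Icc (0 : ℝ) 1 := by
      rw [Complex.mem_reProdIm]
      have e1 : (muFun n u).re = u := by simp [muFun]
      have e2 : (muFun n u).im = vFun n u := by simp [muFun]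
      rw [e1, e2]
      exact ⟨hu, (vFun_spec hn u).1, vFun_le_one hn u⟩
    have hb := hC _ hμ
    rw [Prod.norm_mk, max_le_iff] at hb
    have hnorm := norm_sin_muFun hn u
    set μ := muFun n u
    obtain ⟨e1, e2⟩ := sin_cos_half_identities n μ
    have h4 : trig k (((n : ℂ) + 1) * μ / 2) = fFun n k u * trig k (((n : ℂ) - 1) * μ / 2) := by
      rw [h1, div_mul_cancel₀ _ h3]
    have h3' := norm_ne_zero_iff.2 h3
    rw [e1, e2] at hnorm
    generalize fFun n k u = ρ at *
    cases k
    · simp only [trig] at h3 h3' h4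
      refine norm_le_of_balanced hn h4 hb.1 hb.2 (Complex.sin_sq_add_cos_sq _) ?_
      apply mul_left_cancel₀ h3'
      rw [h4] at hnorm
      generalize Complex.sin (((n : ℂ) - 1) * μ / 2) = a at *
      rw [show ∀ b B : ℂ, ρ * a * b + B * a = a * (ρ * b + B) by intros; ring,
        show ∀ b B : ℂ, ρ * a * b - B * a = a * (ρ * b - B) by intros; ring, norm_mul,
        norm_mul] at hnorm
      linarith
    · simp only [trig] at h3 h3' h4
      refine norm_le_of_balanced hn h4 hb.2 hb.1 (Complex.cos_sq_add_sin_sq _) ?_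
      apply mul_left_cancel₀ h3'
      rw [h4] at hnorm
      generalize Complex.cos (((n : ℂ) - 1) * μ / 2) = a at *
      rw [show ∀ b B : ℂ, B * a + ρ * a * b = a * (ρ * b + B) by intros; ring,
        show ∀ b B : ℂ, B * a - ρ * a * b = -(a * (ρ * b - B)) by intros; ring, norm_neg, norm_mul,
        norm_mul] at hnorm
      linarith

/-! ### An eigenvalue of modulus `n` forces `ρ` onto the borderline curve -/

theorem exists_cos_eq (w : ℂ) :
    ∃ u v : ℝ, u ∈ Set.Icc (-Real.pi) Real.pi ∧ 0 ≤ v ∧ Complex.cos (u + v * Complex.I) = w := by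
  obtain ⟨μ, hμ, him⟩ : ∃ μ : ℂ, Complex.cos μ = w ∧ 0 ≤ μ.im := by
    obtain ⟨μ, hμ⟩ := Complex.cos_surjective w
    rcases le_total 0 μ.im with h | h
    · exact ⟨μ, hμ, h⟩
    · exact ⟨-μ, by rw [Complex.cos_neg, hμ], by simpa using h⟩
  obtain ⟨m, ⟨h1, h2⟩, -⟩ := existsUnique_sub_zsmul_mem_Ioc Real.two_pi_pos μ.re (-Real.pi)
  refine ⟨μ.re - m • (2 * Real.pi), μ.im, ⟨h1.le, by linarith⟩, him, ?_⟩
  have : ((μ.re - m • (2 * Real.pi) : ℝ) : ℂ) + μ.im * Complex.I = μ - m * (2 * Real.pi) := by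
    conv_rhs => rw [← Complex.re_add_im μ]
    simp only [zsmul_eq_mul]
    push_cast
    ring
  rw [this, Complex.cos_sub_int_mul_two_pi, hμ]

theorem trig_three_term (k : EigenType) (x μ : ℂ) :
    trig k (x + μ) = 2 * Complex.cos μ * trig k x - trig k (x - μ) := by
  cases k
  · simp only [trig, Complex.sin_add, Complex.sin_sub]; ring
  · simp only [trig, Complex.cos_add, Complex.cos_sub]; ring

theorem trig_neg (k : EigenType) (z : ℂ) : trig k (-z) = k.sign * trig k z := by
  cases k <;> simp [trig, EigenType.sign]

section

variable {n : ℕ} {k : EigenType} {ρ l μ : ℂ} {y : Fin n → ℂ}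

/-- The secular equation for the sequence `trig k ((j - (n-1)/2) μ)`, which is centred at the middle
of the index range. -/
theorem trig_secular_equation (hρ : ρ ≠ 0) (hl : l ≠ 0)
    (hw : l * (1 - 2 * ρ * Complex.cos μ + ρ ^ 2) = 1 - ρ ^ 2)
    (hy : (kmsMatrix n ρ).mulVec y = l • y) (hy0 : y ≠ 0) (hk : HasSymmetry k y) :
    trig k (((n : ℂ) + 1) * μ / 2) = ρ * trig k (((n : ℂ) - 1) * μ / 2) := by
  have h := secular_equation hρ hl hw hy hy0 hk
    (S := fun j : ℤ => trig k (((j : ℂ) - ((n : ℂ) - 1) / 2) * μ)) (fun j => by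
      have h1 := trig_three_term k (((j : ℂ) - ((n : ℂ) - 1) / 2) * μ) μ
      push_cast
      convert h1 using 2
      · ring
      · congr 1; ring) (fun j => by
      rw [← trig_neg]
      push_cast
      congr 1
      ring)
  rw [show (((-1 : ℤ) : ℂ) - ((n : ℂ) - 1) / 2) * μ = -(((n : ℂ) + 1) * μ / 2) by push_cast; ring,
    show (((0 : ℤ) : ℂ) - ((n : ℂ) - 1) / 2) * μ = -(((n : ℂ) - 1) * μ / 2) by push_cast; ring,
    trig_neg, trig_neg] at h
  linear_combination k.sign * h - (trig k (((n : ℂ) + 1) * μ / 2)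
    - ρ * trig k (((n : ℂ) - 1) * μ / 2)) * k.sign_sq

/-- At the double points `cos μ = c = ±1` of the recurrence the solution of the required symmetry
is `c ^ j` times a linear function. -/
theorem linear_secular_equation (hn : 2 ≤ n) (hρ : ρ ≠ 0) (hl : l ≠ 0) {c : ℂ} (hc : c * c = 1)
    (hw : l * (1 - 2 * ρ * c + ρ ^ 2) = 1 - ρ ^ 2)
    (hy : (kmsMatrix n ρ).mulVec y = l • y) (hy0 : y ≠ 0) (hk : HasSymmetry k y)
    (hkc : k.sign = -c ^ (n - 1)) : ρ = c * xi n := by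
  have hc0 : c ≠ 0 := left_ne_zero_of_mul_eq_one hc
  have hpow : ∀ j : ℤ, c ^ (-j) = c ^ j := by
    intro j
    rw [← inv_zpow', inv_eq_of_mul_eq_one_right hc]
  have h := secular_equation hρ hl hw hy hy0 hk
    (S := fun j : ℤ => c ^ j * ((j : ℂ) - ((n : ℂ) - 1) / 2)) (fun j => by
      have e1 : c ^ (j + 1) = c ^ j * c := zpow_add_one₀ hc0 j
      have e2 : c ^ (j - 1) = c ^ j * c := by
        rw [zpow_sub_one₀ hc0, inv_eq_of_mul_eq_one_right hc]
      rw [e1, e2]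
      push_cast
      ring) (fun j => by
      have e1 : c ^ ((n : ℤ) - 1 - j) = c ^ (n - 1) * c ^ j := by
        rw [sub_eq_add_neg, zpow_add₀ hc0, hpow, ← zpow_natCast, Nat.cast_sub (by omega)]
        rfl
      rw [e1, hkc]
      push_cast
      ring)
  have e1 : c ^ (-1 : ℤ) = c := by rw [zpow_neg_one, inv_eq_of_mul_eq_one_right hc]
  simp only [e1, zpow_zero, one_mul] at h
  push_cast at h
  have hn1 : (n : ℂ) - 1 ≠ 0 := sub_ne_zero.2 (by exact_mod_cast (by omega : n ≠ 1))
  rw [xi, mul_div_assoc', eq_div_iff hn1]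
  linear_combination (2 : ℂ) * h

end

/-- With `a` and `b` the numerator and the denominator of `f_n^{(k)}`, one has
`a² - b² = ∓ sin (n μ) sin μ` and `a² + b² - 2 a b cos μ = sin² μ`. -/
theorem trig_identities (n : ℕ) (k : EigenType) (μ : ℂ) :
    trig k (((n : ℂ) + 1) * μ / 2) ^ 2 - trig k (((n : ℂ) - 1) * μ / 2) ^ 2 =
      -k.sign * (Complex.sin (n * μ) * Complex.sin μ) ∧
    trig k (((n : ℂ) + 1) * μ / 2) ^ 2 + trig k (((n : ℂ) - 1) * μ / 2) ^ 2 -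
      2 * trig k (((n : ℂ) + 1) * μ / 2) * trig k (((n : ℂ) - 1) * μ / 2) * Complex.cos μ =
      Complex.sin μ ^ 2 := by
  set x := ((n : ℂ) - 1) * μ / 2 with hx
  have e1 : ((n : ℂ) + 1) * μ / 2 = x + μ := by rw [hx]; ring
  have e2 : (n : ℂ) * μ = (x + μ) + x := by rw [hx]; ring
  rw [e1, e2]
  have h1 := Complex.sin_sq_add_cos_sq x
  have h2 := Complex.sin_sq_add_cos_sq μ
  cases k
  · simp only [trig, EigenType.sign, Complex.sin_add, Complex.cos_add]
    generalize Complex.sin x = s at *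
    generalize Complex.cos x = c at *
    generalize Complex.sin μ = S at *
    generalize Complex.cos μ = C at *
    constructor
    · linear_combination s ^ 2 * h2
    · linear_combination -s ^ 2 * h2 + S ^ 2 * h1
  · simp only [trig, EigenType.sign, Complex.sin_add, Complex.cos_add]
    generalize Complex.sin x = s at *
    generalize Complex.cos x = c at *
    generalize Complex.sin μ = S at *
    generalize Complex.cos μ = C at *
    constructor
    · linear_combination c ^ 2 * h2
    · linear_combination -c ^ 2 * h2 + S ^ 2 * h1

/-- The eigenvalue in terms of `μ`: `l = ± sin (n μ) / sin μ`. -/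
theorem sin_nat_mul_eq_of_secular {n : ℕ} {k : EigenType} {ρ l μ : ℂ}
    (hw : l * (1 - 2 * ρ * Complex.cos μ + ρ ^ 2) = 1 - ρ ^ 2)
    (h : trig k (((n : ℂ) + 1) * μ / 2) = ρ * trig k (((n : ℂ) - 1) * μ / 2))
    (hs : Complex.sin μ ≠ 0) :
    Complex.sin (n * μ) = k.sign * l * Complex.sin μ := by
  obtain ⟨h1, h2⟩ := trig_identities n k μ
  rw [h] at h1 h2
  apply mul_right_cancel₀ hs
  set b := trig k (((n : ℂ) - 1) * μ / 2)
  linear_combination k.sign * h1 + k.sign * l * h2 - k.sign * b ^ 2 * hw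
    - Complex.sin (n * μ) * Complex.sin μ * k.sign_sq

theorem mem_borderlineCurve {n : ℕ} (hn : 2 ≤ n) {k : EigenType} {ρ l : ℂ}
    (h : IsTypeEigenvalue n k ρ l) (hl : ‖l‖ = n) : ρ ∈ borderlineCurve n k := by
  obtain ⟨y, hy0, hy, hk⟩ := isTypeEigenvalue_iff.1 h
  have hn0 : (2 : ℝ) ≤ n := by exact_mod_cast hn
  have hl0 : l ≠ 0 := by
    rintro rfl
    rw [norm_zero] at hl
    linarith
  have hρ : ρ ≠ 0 := by
    rintro rfl
    rw [kmsMatrix_zero, Matrix.one_mulVec] at hy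
    have h1 : (1 - l) • y = 0 := by rw [sub_smul, one_smul, ← hy, sub_self]
    have h2 := (smul_eq_zero.1 h1).resolve_right hy0
    rw [← sub_eq_zero.1 h2, norm_one] at hl
    linarith
  obtain ⟨w, hw⟩ := exists_recurrence_coeff hρ hl0
  obtain ⟨u, v, hu, hv, rfl⟩ := exists_cos_eq w
  have hsec := trig_secular_equation hρ hl0 hw hy hy0 hk
  -- `sin μ = 0` forces `v = 0`, where both sides of the defining equation vanish
  have hvF : vFun n u = v := by
    refine vFun_eq hn hv ?_
    by_cases hs : Complex.sin (u + v * Complex.I) = 0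
    · obtain ⟨h1, h2⟩ := sin_add_mul_I_eq_zero hs
      rw [h2, hFun_zero, gFun_of_sin_eq_zero n h1]
    · rw [← norm_sin_nat_mul_eq_iff, sin_nat_mul_eq_of_secular hw hsec hs, norm_mul, norm_mul, hl]
      cases k <;> simp [EigenType.sign]
  have hμ : (u : ℂ) + v * Complex.I = muFun n u := by rw [muFun, hvF]
  rw [hμ] at hw hsec
  refine ⟨u, hu, ?_⟩
  rcases fFun_cases hn k hu with ⟨rfl, rfl, h1⟩ | ⟨hpi, hkn, h1⟩ | ⟨h1, -, h3⟩
  · rw [muFun_of_sin_eq_zero hn Real.sin_zero, Complex.ofReal_zero, Complex.cos_zero] at hw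
    rw [h1, linear_secular_equation hn hρ hl0 (one_mul 1) hw hy hy0 hk (by simp [EigenType.sign]),
      one_mul]
  · have hs : Real.sin u = 0 := by rcases hpi with rfl | rfl <;> simp
    have hc : Complex.cos (muFun n u) = -1 := by
      rw [muFun_of_sin_eq_zero hn hs]
      rcases hpi with rfl | rfl <;> simp
    rw [hc] at hw
    have hkc : k.sign = -(-1) ^ (n - 1) := by
      obtain ⟨m, rfl⟩ : ∃ m, n = m + 1 := ⟨n - 1, by omega⟩
      rw [hkn, Nat.add_sub_cancel, pow_succ]
      ring
    rw [h1, linear_secular_equation hn hρ hl0 (by norm_num) hw hy hy0 hk hkc]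
    ring
  · rw [h1, hsec, mul_div_cancel_right₀ _ h3]

/-! ### Counting on the components of the complement -/

theorem continuousAt_extraordinaryCount {n : ℕ} (hn : 2 ≤ n) {k : EigenType} {ρ : ℂ}
    (hρ : ρ ∉ borderlineCurve n k) : ContinuousAt (extraordinaryCount n k) ρ := by
  rw [ContinuousAt, nhds_discrete ℕ, tendsto_pure]
  simp only [extraordinaryCount_eq_eigenCount hn]
  refine eventually_eigenCount_eq (F := fun ρ => typeBlock k (kmsMatrix n ρ))
    ((continuous_typeBlock k).comp (continuous_kmsMatrix n)).continuousAt _ fun l hl => ?_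
  have hne : ‖l‖ ≠ n := by
    intro h
    have hn0 : (2 : ℝ) ≤ n := by exact_mod_cast hn
    have hl1 : l ≠ 1 := by
      rintro rfl
      rw [norm_one] at h
      linarith
    exact hρ (mem_borderlineCurve hn (isTypeEigenvalue_of_mem_roots hl hl1) h)
  rcases hne.lt_or_gt with h | h
  · filter_upwards [continuous_norm.continuousAt.eventually_lt_const h] with z hz
    exact iff_of_false hz.not_gt h.not_gt
  · filter_upwards [continuous_norm.continuousAt.eventually_const_lt h] with z hz
    exact iff_of_true hz h

theorem extraordinaryCount_eq_of_mem_component {n : ℕ} (hn : 2 ≤ n) {k : EigenType} {ρ₀ ρ : ℂ}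
    (hρ₀ : ρ₀ ∈ (borderlineCurve n k)ᶜ)
    (h : ρ ∈ connectedComponentIn (borderlineCurve n k)ᶜ ρ₀) :
    extraordinaryCount n k ρ = extraordinaryCount n k ρ₀ :=
  isPreconnected_connectedComponentIn.constant
    (fun _ hz => (continuousAt_extraordinaryCount hn
      (connectedComponentIn_subset _ _ hz)).continuousWithinAt)
    h (mem_connectedComponentIn hρ₀)

/-- The exterior of a disk is the image of a half-plane under the exponential function. -/
theorem isPreconnected_norm_gt {R : ℝ} (hR : 0 < R) : IsPreconnected {z : ℂ | R < ‖z‖} := by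
  have h : {z : ℂ | R < ‖z‖} = Complex.exp '' {z : ℂ | Real.log R < z.re} := by
    ext z
    simp only [Set.mem_ofPred_eq, Set.mem_image]
    constructor
    · intro hz
      have hz0 : z ≠ 0 := norm_pos_iff.1 (hR.trans hz)
      exact ⟨Complex.log z, by rw [Complex.log_re]; exact Real.log_lt_log hR hz,
        Complex.exp_log hz0⟩
    · rintro ⟨w, hw, rfl⟩
      rw [Complex.norm_exp]
      exact (Real.log_lt_iff_lt_exp hR).1 hw
  rw [h]
  exact (convex_halfSpace_re_gt _).isPreconnected.image _ Complex.continuous_exp.continuousOn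

/-- The complement of a bounded set in the plane has exactly one unbounded component, the one that
contains the exterior of a large disk. -/
theorem exists_unbounded_component {B : Set ℂ} {R : ℝ} (hB : ∀ z ∈ B, ‖z‖ ≤ R) {z₀ : ℂ} (hR : 0 < R)
    (hz₀ : R < ‖z₀‖) :
    ¬ Bornology.IsBounded (connectedComponentIn Bᶜ z₀) ∧
      ∀ E', IsComplComponent B E' → ¬ Bornology.IsBounded E' →
        E' = connectedComponentIn Bᶜ z₀ := by
  have hout : {z : ℂ | R < ‖z‖} ⊆ Bᶜ := fun z hz hzB => (hB z hzB).not_gt hz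
  have hsub : {z : ℂ | R < ‖z‖} ⊆ connectedComponentIn Bᶜ z₀ :=
    (isPreconnected_norm_gt hR).subset_connectedComponentIn hz₀ hout
  constructor
  · intro hb
    obtain ⟨M, hM⟩ := (hb.subset hsub).exists_norm_le
    have h1 : 0 < max R M + 1 := by linarith [le_max_left R M]
    have hnorm : ‖((max R M + 1 : ℝ) : ℂ)‖ = max R M + 1 := by
      rw [Complex.norm_real, Real.norm_of_nonneg h1.le]
    have h2 := hM ((max R M + 1 : ℝ) : ℂ) (by
      rw [Set.mem_ofPred_eq, hnorm]; linarith [le_max_left R M])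
    rw [hnorm] at h2
    linarith [le_max_right R M]
  · rintro _ ⟨z, hz, rfl⟩ hunb
    obtain ⟨x, hx, hxR⟩ : ∃ x ∈ connectedComponentIn Bᶜ z, R < ‖x‖ := by
      by_contra! hcon
      exact hunb (isBounded_iff_forall_norm_le.2 ⟨R, hcon⟩)
    rw [connectedComponentIn_eq hx, connectedComponentIn_eq (hsub hxR)]

theorem exists_two_extraordinary {n : ℕ} (hn : 2 ≤ n) {ρ : ℂ} (hρ : ρ ≠ 0)
    (hcount : ∀ k, extraordinaryCount n k ρ = 1) :
    ∃ l₁ l₂ : ℂ, l₁ ≠ l₂ ∧ extraordinary n ρ = {l₁, l₂} ∧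
      IsTypeEigenvalue n .type1 ρ l₁ ∧ ¬ IsTypeEigenvalue n .type2 ρ l₁ ∧
      IsTypeEigenvalue n .type2 ρ l₂ ∧ ¬ IsTypeEigenvalue n .type1 ρ l₂ := by
  classical
  have hex : ∀ k, ∃ l, (typeBlock k (kmsMatrix n ρ)).charpoly.roots.filter (Large n) = {l} := by
    intro k
    have h := hcount k
    rw [extraordinaryCount_eq_eigenCount hn, eigenCount, Multiset.countP_eq_card_filter] at h
    exact Multiset.card_eq_one.1 h
  have htype : ∀ k l, (typeBlock k (kmsMatrix n ρ)).charpoly.roots.filter (Large n) = {l} →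
      IsTypeEigenvalue n k ρ l ∧ l ≠ 0 := by
    intro k l h
    have hmem : l ∈ (typeBlock k (kmsMatrix n ρ)).charpoly.roots.filter (Large n) := by
      rw [h]; exact Multiset.mem_singleton_self l
    rw [Multiset.mem_filter] at hmem
    exact ⟨isTypeEigenvalue_of_mem_roots hmem.1 (hmem.2.ne_one hn), hmem.2.ne_zero⟩
  obtain ⟨l₁, h1⟩ := hex .type1
  obtain ⟨l₂, h2⟩ := hex .type2
  obtain ⟨t1, z1⟩ := htype _ _ h1
  obtain ⟨t2, z2⟩ := htype _ _ h2
  have n1 : ¬ IsTypeEigenvalue n .type2 ρ l₁ := not_isTypeEigenvalue_both hρ z1 t1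
  have n2 : ¬ IsTypeEigenvalue n .type1 ρ l₂ := fun h => not_isTypeEigenvalue_both hρ z2 h t2
  refine ⟨l₁, l₂, ?_, ?_, t1, n1, t2, n2⟩
  · rintro rfl
    exact n1 t2
  · rw [extraordinary_eq_add hn]
    convert congrArg₂ (· + ·) h1 h2 using 1
    rfl

end KMS

theorem mainTheorem6 (n : ℕ) (hn : 2 ≤ n) :
    (∀ k : KMS.EigenType,
      (∃ O : Set ℂ, KMS.IsComplComponent (KMS.borderlineCurve n k) O ∧ (0 : ℂ) ∈ O ∧
        ∀ ρ ∈ O, KMS.extraordinaryCount n k ρ = 0) ∧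
      (∃ E : Set ℂ, KMS.IsComplComponent (KMS.borderlineCurve n k) E ∧
        ¬ Bornology.IsBounded E ∧
        (∀ E' : Set ℂ, KMS.IsComplComponent (KMS.borderlineCurve n k) E' →
          ¬ Bornology.IsBounded E' → E' = E) ∧
        ∀ ρ ∈ E, KMS.extraordinaryCount n k ρ = 1)) ∧
    (∃ R : ℝ, ∀ ρ : ℂ, R < ‖ρ‖ →
      ∃ l₁ l₂ : ℂ, l₁ ≠ l₂ ∧ KMS.extraordinary n ρ = {l₁, l₂} ∧
        KMS.IsTypeEigenvalue n .type1 ρ l₁ ∧ ¬ KMS.IsTypeEigenvalue n .type2 ρ l₁ ∧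
        KMS.IsTypeEigenvalue n .type2 ρ l₂ ∧ ¬ KMS.IsTypeEigenvalue n .type1 ρ l₂) := by
  obtain ⟨R₁, hR₁⟩ := KMS.exists_extraordinaryCount_eq_one hn
  obtain ⟨R₂, hR₂⟩ := KMS.exists_bound_borderlineCurve hn
  refine ⟨fun k => ⟨?_, ?_⟩, max 0 R₁, fun ρ hρ => ?_⟩
  · have h0 := KMS.zero_notMem_borderlineCurve hn k
    refine ⟨_, ⟨0, h0, rfl⟩, mem_connectedComponentIn h0, fun ρ hρ => ?_⟩
    rw [KMS.extraordinaryCount_eq_of_mem_component hn h0 hρ,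
      KMS.extraordinaryCount_eq_eigenCount hn, KMS.eigenCount_kmsMatrix_zero hn]
  · set R := max 1 (max R₁ R₂) with hR
    have hpos : 0 < R := zero_lt_one.trans_le (le_max_left _ _)
    have hR1 : R₁ ≤ R := (le_max_left _ _).trans (le_max_right _ _)
    have hR2 : R₂ ≤ R := (le_max_right _ _).trans (le_max_right _ _)
    have hnorm : R < ‖((R + 1 : ℝ) : ℂ)‖ := by
      rw [Complex.norm_real, Real.norm_of_nonneg (by linarith)]
      linarith
    have hbound : ∀ z ∈ KMS.borderlineCurve n k, ‖z‖ ≤ R := fun z hz => (hR₂ k z hz).trans hR2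
    have hmem : ((R + 1 : ℝ) : ℂ) ∈ (KMS.borderlineCurve n k)ᶜ := fun h =>
      (hbound _ h).not_gt hnorm
    obtain ⟨hunb, huniq⟩ := KMS.exists_unbounded_component hbound hpos hnorm
    refine ⟨_, ⟨_, hmem, rfl⟩, hunb, huniq, fun ρ hρ => ?_⟩
    rw [KMS.extraordinaryCount_eq_of_mem_component hn hmem hρ]
    exact hR₁ _ (hR1.trans_lt hnorm) k
  · have h0 : 0 < ‖ρ‖ := (le_max_left _ _).trans_lt hρ
    exact KMS.exists_two_extraordinary hn (norm_pos_iff.1 h0)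
      (hR₁ ρ ((le_max_right _ _).trans_lt hρ))
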